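/- Let $p>2$, $n>2$. Let $(T,h)$ and $(M,\varphi)$ be smooth semi-Riemannian manifolds of dimensions $p$ and $n$, with local coordinates $t^\alpha$ and $x^i$. Let $J^1(T,M)=\{(t,x,y): y\in \mathrm{Hom}(T_tT,T_xM)\}$ with induced coordinates $(t^\alpha,x^i,x^i_\alpha)$, let $\sigma:J^1(T,M)\to\mathbb R$ be smooth, and put $g_{ij}=e^{2\sigma}\varphi_{ij}$. Let $H^\gamma_{\alpha\beta}$, $\gamma^k_{ij}$ be the Christoffel symbols of $h$, $\varphi$. Let $r^l_{ijk}=\partial_k\gamma^l_{ij}-\partial_j\gamma^l_{ik}+\gamma^m_{ij}\gamma^l_{mk}-\gamma^m_{ik}\gamma^l_{mj}$, $r_{ij}=r^m_{ijm}$, $r=\varphi^{ij}r_{ij}$, and let $H_{\alpha\beta}$, $H=h^{\alpha\beta}H_{\alpha\beta}$ be the Ricci tensor and the scalar curvature of $h$, with the same convention. **Adapted basis.** Use the nonlinear connection $M^{(i)}_{(\alpha)\beta}=-H^\mu_{\alpha\beta}x^i_\mu$, $N^{(i)}_{(\alpha)j}=\gamma^i_{jm}x^m_\alpha$, with adapted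 basis $X_A$: $$\frac{\delta}{\delta t^\alpha}=\frac{\partial}{\partial t^\alpha}-M^{(j)}_{(\beta)\alpha}\frac{\partial}{\partial x^j_\beta},\qquad \frac{\delta}{\delta x^i}=\frac{\partial}{\partial x^i}-N^{(j)}_{(\beta)i}\frac{\partial}{\partial x^j_\beta},\qquad \frac{\partial}{\partial x^i_\alpha},$$ and dual basis $dt^\alpha$, $dx^i$, $\delta x^i_\alpha=dx^i_\alpha+M^{(i)}_{(\alpha)\beta}dt^\beta+N^{(i)}_{(\alpha)j}dx^j$. Let $$G=h_{\alpha\beta}\,dt^\alpha\otimes dt^\beta+e^{2\sigma}\varphi_{ij}\,dx^i\otimes dx^j+h^{\alpha\beta}e^{2\sigma}\varphi_{ij}\,\delta x^i_\alpha\otimes\delta x^j_\beta .$$ **Cartan canonical connection.** $C\Gamma=(H^\gamma_{\alpha\beta},G^k_{j\gamma},L^k_{ij},C^{i(\gamma)}_{j(k)})$ is the linear connection with $$G^k_{j\gamma}=\tfrac12 g^{km}\frac{\delta g_{mj}}{\delta t^\gamma},\quad L^k_{ij}=\tfrac12 g^{km}\Big(\frac{\delta g_{jm}}{\delta x^i}+\frac{\delta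 g_{im}}{\delta x^j}-\frac{\delta g_{ij}}{\delta x^m}\Big),\quad C^{i(\gamma)}_{j(k)}=\tfrac12 g^{im}\Big(\frac{\partial g_{jm}}{\partial x^k_\gamma}+\frac{\partial g_{km}}{\partial x^j_\gamma}-\frac{\partial g_{jk}}{\partial x^m_\gamma}\Big).$$ Its nonzero covariant derivatives of basis vectors are $$\nabla_{\frac{\delta}{\delta t^\beta}}\frac{\delta}{\delta t^\alpha}=H^\gamma_{\alpha\beta}\frac{\delta}{\delta t^\gamma},\quad \nabla_{\frac{\delta}{\delta t^\gamma}}\frac{\delta}{\delta x^j}=G^k_{j\gamma}\frac{\delta}{\delta x^k},\quad \nabla_{\frac{\delta}{\delta x^i}}\frac{\delta}{\delta x^j}=L^k_{ji}\frac{\delta}{\delta x^k},\quad \nabla_{\frac{\partial}{\partial x^m_\gamma}}\frac{\delta}{\delta x^j}=C^{k(\gamma)}_{j(m)}\frac{\delta}{\delta x^k},$$ $$\nabla_{\frac{\delta}{\delta t^\gamma}}\frac{\partial}{\partial x^i_\alpha}=G^k_{i\gamma}\frac{\partial}{\partial x^k_\alpha}-H^\alpha_{\beta\gamma}\frac{\partial}{\partial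 x^i_\beta},\quad \nabla_{\frac{\delta}{\delta x^j}}\frac{\partial}{\partial x^i_\alpha}=L^k_{ij}\frac{\partial}{\partial x^k_\alpha},\quad \nabla_{\frac{\partial}{\partial x^m_\gamma}}\frac{\partial}{\partial x^i_\alpha}=C^{k(\gamma)}_{i(m)}\frac{\partial}{\partial x^k_\alpha}.$$ With $\mathbf R(X,Y)Z=\nabla_X\nabla_YZ-\nabla_Y\nabla_XZ-\nabla_{[X,Y]}Z$ and $\mathbf R(X_C,X_B)X_A=R^D_{ABC}X_D$, put $\mathrm{Ric}(C\Gamma)(X_A,X_B)=R^D_{ABD}$ and $Sc(C\Gamma)=G^{AB}\mathrm{Ric}(C\Gamma)(X_A,X_B)$. Write $$R_{i\alpha}=\mathrm{Ric}\Big(\frac{\delta}{\delta x^i},\frac{\delta}{\delta t^\alpha}\Big),\ R_{ij}=\mathrm{Ric}\Big(\frac{\delta}{\delta x^i},\frac{\delta}{\delta x^j}\Big),\ P^{(\alpha)}_{(i)\beta}=\mathrm{Ric}\Big(\frac{\partial}{\partial x^i_\alpha},\frac{\delta}{\delta t^\beta}\Big),$$ $$P^{(\alpha)}_{(i)j}=\mathrm{Ric}\Big(\frac{\partial}{\partial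 x^i_\alpha},\frac{\delta}{\delta x^j}\Big),\ P^{\;(\alpha)}_{i(j)}=\mathrm{Ric}\Big(\frac{\delta}{\delta x^i},\frac{\partial}{\partial x^j_\alpha}\Big),\ S^{(\alpha)(\beta)}_{(i)(j)}=\mathrm{Ric}\Big(\frac{\partial}{\partial x^i_\alpha},\frac{\partial}{\partial x^j_\beta}\Big),$$ and $R=e^{-2\sigma}\varphi^{ij}R_{ij}$, $S=h_{\alpha\beta}e^{-2\sigma}\varphi^{ij}S^{(\alpha)(\beta)}_{(i)(j)}$. **Derivatives of $\sigma$.** Let $\sigma_i=\delta\sigma/\delta x^i$, $\sigma^{(\alpha)}_{(i)}=\partial\sigma/\partial x^i_\alpha$, $\sigma^{i\alpha}=\varphi^{im}\sigma^{(\alpha)}_{(m)}$, $$\sigma_{jk}=\frac{\delta\sigma_j}{\delta x^k}-\gamma^m_{jk}\sigma_m-\sigma_j\sigma_k+\tfrac12\varphi_{jk}\varphi^{rm}\sigma_r\sigma_m,\qquad \langle\sigma\rangle=\varphi^{rs}\sigma_{rs},$$ $$\sigma^{(\beta)(\gamma)}_{(j)(k)}=\frac{\partial\sigma^{(\beta)}_{(j)}}{\partial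 x^k_\gamma}-\sigma^{(\beta)}_{(j)}\sigma^{(\gamma)}_{(k)}+\tfrac12\varphi_{jk}\varphi^{rm}\sigma^{(\beta)}_{(r)}\sigma^{(\gamma)}_{(m)},\qquad \langle\langle\sigma\rangle\rangle=h_{\alpha\beta}\varphi^{rs}\sigma^{(\alpha)(\beta)}_{(r)(s)}.$$ **Theorem.** Let $\mathcal T$ be a $(0,2)$ d-tensor on $J^1(T,M)$, with components $\mathcal T_{AB}$ in the adapted basis, and let $\mathcal K\neq0$. In all such coordinates and at every jet, the Einstein equations $$\mathrm{Ric}(C\Gamma)-\frac{Sc(C\Gamma)}{2}\,G=\mathcal K\,\mathcal T$$ hold if and only if both of the following systems hold: $$(E_1')\quad\begin{cases}H_{\alpha\beta}-\frac H2h_{\alpha\beta}=\mathcal K\tilde{\mathcal T}_{\alpha\beta},\\ r_{ij}-\frac r2\varphi_{ij}+\rho_{ij}=\mathcal K\tilde{\mathcal T}_{ij},\\ S^{(\alpha)(\beta)}_{(i)(j)}+(n-1)\langle\langle\sigma\rangle\rangle h^{\alpha\beta}\varphi_{ij}=\mathcal K\tilde{\mathcal T}^{(\alpha)(\beta)}_{(i)(j)},\end{cases}$$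 $$(E_2)\quad\begin{cases}0=\mathcal T_{\alpha i},\quad R_{i\alpha}=\mathcal K\mathcal T_{i\alpha},\quad P^{(\alpha)}_{(i)\beta}=\mathcal K\mathcal T^{(\alpha)}_{(i)\beta},\\ 0=\mathcal T^{\;(\beta)}_{\alpha(i)},\quad P^{\;(\alpha)}_{i(j)}=\mathcal K\mathcal T^{\;(\alpha)}_{i(j)},\quad P^{(\alpha)}_{(i)j}=\mathcal K\mathcal T^{(\alpha)}_{(i)j},\end{cases}$$ where $$\tilde{\mathcal T}_{\alpha\beta}=\mathcal T_{\alpha\beta}+\frac{R+S}{2\mathcal K}h_{\alpha\beta},\quad \tilde{\mathcal T}_{ij}=\mathcal T_{ij}+\frac{H+S}{2\mathcal K}e^{2\sigma}\varphi_{ij},\quad \tilde{\mathcal T}^{(\alpha)(\beta)}_{(i)(j)}=\mathcal T^{(\alpha)(\beta)}_{(i)(j)}+\frac{H+R}{2\mathcal K}h^{\alpha\beta}e^{2\sigma}\varphi_{ij},$$ $$\rho_{ij}=(2-n)\sigma_{ij}-(2-n)\langle\sigma\rangle\varphi_{ij}-\big[\varphi_{is}r^s_{mjq}+r_{mq}\varphi_{ij}-r_{mj}\varphi_{iq}\big]\sigma^{q\mu}x^m_\mu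 .$$ -/

import Mathlib

open scoped Manifold ContDiff

noncomputable section

namespace JetGR

/-- The model space `ℝ^d`. -/
abbrev Eu (d : ℕ) := EuclideanSpace ℝ (Fin d)

/-! ### Semi-Riemannian manifolds and the 1-jet space -/

section Manifolds

variable {d : ℕ} {X : Type*} [TopologicalSpace X] [ChartedSpace (Eu d) X]

/-- The coordinate vector `∂/∂x^i` of the chart `e` at the point with coordinates `ξ`. -/
def coordVec (e : OpenPartialHomeomorph X (Eu d)) (ξ : Eu d) (i : Fin d) :
    TangentSpace (𝓡 d) (e.symm ξ) :=
  mfderiv (𝓡 d) (𝓡 d) e.symm ξ (EuclideanSpace.single i (1 : ℝ) : Eu d)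

/-- The coordinate covector `dx^i` of the chart `e` at the point with coordinates `ξ`. -/
def coordCovec (e : OpenPartialHomeomorph X (Eu d)) (ξ : Eu d) (i : Fin d) :
    TangentSpace (𝓡 d) (e.symm ξ) →L[ℝ] ℝ :=
  (EuclideanSpace.proj i : Eu d →L[ℝ] ℝ).comp
    (mfderiv (𝓡 d) (𝓡 d) e (e.symm ξ) : TangentSpace (𝓡 d) (e.symm ξ) →L[ℝ] Eu d)

/-- A (smooth) semi-Riemannian metric on a `d`-dimensional manifold: a symmetric nondegenerate
bilinear form of constant index on every tangent space whose components are smooth in every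
chart of the smooth structure. -/
structure SemiRiemannianMetric (d : ℕ) (X : Type*) [TopologicalSpace X]
    [ChartedSpace (Eu d) X] where
  val : ∀ x : X, TangentSpace (𝓡 d) x →ₗ[ℝ] TangentSpace (𝓡 d) x →ₗ[ℝ] ℝ
  symm : ∀ x v w, val x v w = val x w v
  nondegenerate : ∀ x v, (∀ w, val x v w = 0) → v = 0
  index_const : ∃ q : ℕ, ∀ x : X,
    IsGreatest {k : ℕ | ∃ W : Submodule ℝ (TangentSpace (𝓡 d) x),
      Module.finrank ℝ W = k ∧ ∀ v ∈ W, v ≠ 0 → val x v v < 0} q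
  smooth : ∀ e ∈ IsManifold.maximalAtlas (𝓡 d) ∞ X, ∀ i j : Fin d,
    ContDiffOn ℝ ∞ (fun ξ => val (e.symm ξ) (coordVec e ξ i) (coordVec e ξ j)) e.target

/-- The matrix of components of a metric in a chart, as a function of the coordinates. -/
def SemiRiemannianMetric.components (g : SemiRiemannianMetric d X)
    (e : OpenPartialHomeomorph X (Eu d)) (ξ : Eu d) : Matrix (Fin d) (Fin d) ℝ :=
  Matrix.of fun i j => g.val (e.symm ξ) (coordVec e ξ i) (coordVec e ξ j)

end Manifolds

/-- Coordinates `(t^α, x^i, x^i_α)` on the 1-jet space; the last entry is `fun i α => x^i_α`. -/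
abbrev Coords (p n : ℕ) := Eu p × Eu n × (Fin n → Fin p → ℝ)

section Jets

variable {p n : ℕ}

/-- The 1-jet space `J¹(T, M)`: a 1-jet of a map `T → M` is a point `t` of `T`, a point `x` of `M`
and a linear map `T_t T → T_x M`. -/
structure OneJet (p n : ℕ) (T M : Type*) [TopologicalSpace T] [ChartedSpace (Eu p) T]
    [TopologicalSpace M] [ChartedSpace (Eu n) M] where
  t : T
  x : M
  y : TangentSpace (𝓡 p) t →L[ℝ] TangentSpace (𝓡 n) x

variable {T M : Type*} [TopologicalSpace T] [ChartedSpace (Eu p) T]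
  [TopologicalSpace M] [ChartedSpace (Eu n) M]

/-- The jet with coordinates `(t^α, x^i, x^i_α)`; its linear part is `x^i_α dt^α ⊗ ∂/∂x^i`. -/
def jetOfCoords (e : OpenPartialHomeomorph T (Eu p)) (e' : OpenPartialHomeomorph M (Eu n))
    (z : Coords p n) : OneJet p n T M where
  t := e.symm z.1
  x := e'.symm z.2.1
  y := ∑ i, ∑ α, z.2.2 i α • (coordCovec e z.1 α).smulRight (coordVec e' z.2.1 i)

/-- The coordinate domain in the jet space that a chart of `T` and a chart of `M` induce. -/
def jetDomain (e : OpenPartialHomeomorph T (Eu p)) (e' : OpenPartialHomeomorph M (Eu n)) :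
    Set (Coords p n) :=
  {z | z.1 ∈ e.target ∧ z.2.1 ∈ e'.target}

/-- Smoothness of a function on `J¹(T, M)`, in all induced coordinates. -/
def IsSmoothOnJets (σ : OneJet p n T M → ℝ) : Prop :=
  ∀ e ∈ IsManifold.maximalAtlas (𝓡 p) ∞ T, ∀ e' ∈ IsManifold.maximalAtlas (𝓡 n) ∞ M,
    ContDiffOn ℝ ∞ (fun z => σ (jetOfCoords e e' z)) (jetDomain e e')

/-- The splitting of the tangent space of `J¹(T, M)` at a jet by a nonlinear connection: temporal
horizontal part, spatial horizontal part, vertical part. -/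
abbrev DTangent (u : OneJet p n T M) : Type :=
  TangentSpace (𝓡 p) u.t × TangentSpace (𝓡 n) u.x ×
    (TangentSpace (𝓡 p) u.t →L[ℝ] TangentSpace (𝓡 n) u.x)

/-- Distinguished `(0,2)`-tensors on `J¹(T, M)`. -/
abbrev DTensor (p n : ℕ) (T M : Type*) [TopologicalSpace T] [ChartedSpace (Eu p) T]
    [TopologicalSpace M] [ChartedSpace (Eu n) M] :=
  ∀ u : OneJet p n T M, DTangent u →ₗ[ℝ] DTangent u →ₗ[ℝ] ℝ

/-- Indices of the adapted basis: `α`, `i` and the vertical double index `(i, α)`. -/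
abbrev Idx (p n : ℕ) := Fin p ⊕ Fin n ⊕ (Fin n × Fin p)

/-- The temporal index `α`. -/
abbrev tI (n : ℕ) {p : ℕ} (α : Fin p) : Idx p n := Sum.inl α

/-- The spatial index `i`. -/
abbrev xI (p : ℕ) {n : ℕ} (i : Fin n) : Idx p n := Sum.inr (Sum.inl i)

/-- The vertical index `(i, α)`, that is, the index of `∂/∂x^i_α`. -/
abbrev vI (i : Fin n) (α : Fin p) : Idx p n := Sum.inr (Sum.inr (i, α))

/-- The adapted basis, under the splitting: `δ/δt^α`, `δ/δx^i`, `∂/∂x^i_α` correspond to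
`∂/∂t^α`, `∂/∂x^i`, `dt^α ⊗ ∂/∂x^i`. -/
def dFrame (e : OpenPartialHomeomorph T (Eu p)) (e' : OpenPartialHomeomorph M (Eu n))
    (z : Coords p n) : Idx p n → DTangent (jetOfCoords e e' z)
  | .inl α => (coordVec e z.1 α, 0, 0)
  | .inr (.inl i) => (0, coordVec e' z.2.1 i, 0)
  | .inr (.inr (i, α)) => (0, 0, (coordCovec e z.1 α).smulRight (coordVec e' z.2.1 i))

/-- The components `𝒯_{AB}` of a d-tensor in the adapted basis. -/
def DTensor.components (𝒯 : DTensor p n T M) (e : OpenPartialHomeomorph T (Eu p))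
    (e' : OpenPartialHomeomorph M (Eu n)) (z : Coords p n) (A B : Idx p n) : ℝ :=
  𝒯 (jetOfCoords e e' z) (dFrame e e' z A) (dFrame e e' z B)

end Jets

/-! ### Curvature of a semi-Riemannian metric in coordinates -/

section Metric

variable {d : ℕ}

/-- Partial derivative `∂f/∂x^i`. -/
def pd (f : Eu d → ℝ) (i : Fin d) (x : Eu d) : ℝ :=
  fderiv ℝ f x (EuclideanSpace.single i (1 : ℝ))

/-- The Christoffel symbol `Γ^k_{ij}` of a metric. -/
def christoffel (g : Eu d → Matrix (Fin d) (Fin d) ℝ) (k i j : Fin d) (x : Eu d) : ℝ :=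
  (1 / 2) * ∑ m, (g x)⁻¹ k m *
    (pd (fun y => g y j m) i x + pd (fun y => g y i m) j x - pd (fun y => g y i j) m x)

/-- The curvature tensor `r^l_{ijk} = ∂_k Γ^l_{ij} - ∂_j Γ^l_{ik} + Γ^m_{ij} Γ^l_{mk}
- Γ^m_{ik} Γ^l_{mj}`. -/
def riem (g : Eu d → Matrix (Fin d) (Fin d) ℝ) (l i j k : Fin d) (x : Eu d) : ℝ :=
  pd (christoffel g l i j) k x - pd (christoffel g l i k) j x
    + ∑ m, (christoffel g m i j x * christoffel g l m k x
      - christoffel g m i k x * christoffel g l m j x)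

/-- The Ricci tensor `r_{ij} = r^m_{ijm}`. -/
def ricci (g : Eu d → Matrix (Fin d) (Fin d) ℝ) (i j : Fin d) (x : Eu d) : ℝ :=
  ∑ m, riem g m i j m x

/-- The scalar curvature `r = g^{ij} r_{ij}`. -/
def scalar (g : Eu d → Matrix (Fin d) (Fin d) ℝ) (x : Eu d) : ℝ :=
  ∑ i, ∑ j, (g x)⁻¹ i j * ricci g i j x

end Metric

/-! ### Local geometry of the generalized metrical multi-time Lagrange space -/

/-- The coordinate expressions `h_{αβ}(t)`, `φ_{ij}(x)`, `σ(t, x, x^i_α)`. -/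
structure Space (p n : ℕ) where
  h : Eu p → Matrix (Fin p) (Fin p) ℝ
  φ : Eu n → Matrix (Fin n) (Fin n) ℝ
  σ : Coords p n → ℝ

/-- The coordinate expressions of given metrics on `T` and `M` and a function on `J¹(T, M)`. -/
def Space.ofCharts {p n : ℕ} {T M : Type*} [TopologicalSpace T] [ChartedSpace (Eu p) T]
    [TopologicalSpace M] [ChartedSpace (Eu n) M]
    (h : SemiRiemannianMetric p T) (φ : SemiRiemannianMetric n M) (σ : OneJet p n T M → ℝ)
    (e : OpenPartialHomeomorph T (Eu p)) (e' : OpenPartialHomeomorph M (Eu n)) : Space p n where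
  h := h.components e
  φ := φ.components e'
  σ := fun z => σ (jetOfCoords e e' z)

namespace Space

variable {p n : ℕ} (S : Space p n)

/-- `h_{αβ}` as a function on the jet space. -/
def hLow (z : Coords p n) (α β : Fin p) : ℝ := S.h z.1 α β

/-- `h^{αβ}`. -/
def hUp (z : Coords p n) (α β : Fin p) : ℝ := (S.h z.1)⁻¹ α β

/-- `φ_{ij}` as a function on the jet space. -/
def φLow (z : Coords p n) (i j : Fin n) : ℝ := S.φ z.2.1 i j

/-- `φ^{ij}`. -/
def φUp (z : Coords p n) (i j : Fin n) : ℝ := (S.φ z.2.1)⁻¹ i j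

/-- The spatial metrical d-tensor `g_{ij} = e^{2σ} φ_{ij}`. -/
def g (z : Coords p n) : Matrix (Fin n) (Fin n) ℝ :=
  Matrix.of fun i j => Real.exp (2 * S.σ z) * S.φLow z i j

/-- Temporal components `M^{(i)}_{(α)β} = - H^μ_{αβ} x^i_μ` of the nonlinear connection. -/
def nlM (i : Fin n) (α β : Fin p) (z : Coords p n) : ℝ :=
  - ∑ μ, christoffel S.h μ α β z.1 * z.2.2 i μ

/-- Spatial components `N^{(i)}_{(α)j} = γ^i_{jm} x^m_α` of the nonlinear connection. -/
def nlN (i : Fin n) (α : Fin p) (j : Fin n) (z : Coords p n) : ℝ :=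
  ∑ m, christoffel S.φ i j m z.2.1 * z.2.2 m α

/-- The adapted basis `δ/δt^α = ∂/∂t^α - M^{(j)}_{(β)α} ∂/∂x^j_β`,
`δ/δx^i = ∂/∂x^i - N^{(j)}_{(β)i} ∂/∂x^j_β`, `∂/∂x^i_α` of vector fields. -/
def frame : Idx p n → Coords p n → Coords p n
  | .inl α => fun z => (EuclideanSpace.single α 1, 0, fun j β => - S.nlM j β α z)
  | .inr (.inl i) => fun z => (0, EuclideanSpace.single i 1, fun j β => - S.nlN j β i z)
  | .inr (.inr (i, α)) => fun _ => (0, 0, Pi.single i (Pi.single α 1))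

/-- The adapted cobasis `dt^α`, `dx^i`, `δx^i_α = dx^i_α + M^{(i)}_{(α)β} dt^β
+ N^{(i)}_{(α)j} dx^j`, evaluated on a tangent vector `v` at `z`. -/
def coframe : Idx p n → Coords p n → Coords p n → ℝ
  | .inl α => fun _ v => v.1 α
  | .inr (.inl i) => fun _ v => v.2.1 i
  | .inr (.inr (i, α)) => fun z v =>
      v.2.2 i α + ∑ β, S.nlM i α β z * v.1 β + ∑ j, S.nlN i α j z * v.2.1 j

/-- The derivative `X_A f` of a function along an adapted basis vector field. -/
def der (A : Idx p n) (f : Coords p n → ℝ) (z : Coords p n) : ℝ :=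
  fderiv ℝ f z (S.frame A z)

/-- The gravitational `h`-potential `G = h_{αβ} dt^α ⊗ dt^β + e^{2σ} φ_{ij} dx^i ⊗ dx^j
+ h^{αβ} e^{2σ} φ_{ij} δx^i_α ⊗ δx^j_β`. -/
def G (z v w : Coords p n) : ℝ :=
  (∑ α, ∑ β, S.hLow z α β * S.coframe (tI n α) z v * S.coframe (tI n β) z w)
  + (∑ i, ∑ j, Real.exp (2 * S.σ z) * S.φLow z i j
      * S.coframe (xI p i) z v * S.coframe (xI p j) z w)
  + ∑ i, ∑ j, ∑ α, ∑ β, S.hUp z α β * Real.exp (2 * S.σ z) * S.φLow z i j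
      * S.coframe (vI i α) z v * S.coframe (vI j β) z w

/-- The components `G_{AB} = G(X_A, X_B)`. -/
def GLow (A B : Idx p n) (z : Coords p n) : ℝ := S.G z (S.frame A z) (S.frame B z)

/-- The components `G^{AB}` of the inverse metric. -/
def GUp : Idx p n → Idx p n → Coords p n → ℝ
  | .inl α, .inl β => fun z => S.hUp z α β
  | .inr (.inl i), .inr (.inl j) => fun z => Real.exp (-2 * S.σ z) * S.φUp z i j
  | .inr (.inr (i, α)), .inr (.inr (j, β)) =>
      fun z => S.hLow z α β * Real.exp (-2 * S.σ z) * S.φUp z i j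
  | _, _ => fun _ => 0

/-- `G^k_{jγ} = (1/2) g^{km} δg_{mj}/δt^γ`. -/
def cG (k j : Fin n) (γ : Fin p) (z : Coords p n) : ℝ :=
  (1 / 2) * ∑ m, (S.g z)⁻¹ k m * S.der (tI n γ) (fun w => S.g w m j) z

/-- `L^k_{ij} = (1/2) g^{km} (δg_{jm}/δx^i + δg_{im}/δx^j - δg_{ij}/δx^m)`. -/
def cL (k i j : Fin n) (z : Coords p n) : ℝ :=
  (1 / 2) * ∑ m, (S.g z)⁻¹ k m *
    (S.der (xI p i) (fun w => S.g w j m) z + S.der (xI p j) (fun w => S.g w i m) z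
      - S.der (xI p m) (fun w => S.g w i j) z)

/-- `C^{i(γ)}_{j(k)} = (1/2) g^{im} (∂g_{jm}/∂x^k_γ + ∂g_{km}/∂x^j_γ - ∂g_{jk}/∂x^m_γ)`. -/
def cC (i j k : Fin n) (γ : Fin p) (z : Coords p n) : ℝ :=
  (1 / 2) * ∑ m, (S.g z)⁻¹ i m *
    (S.der (vI k γ) (fun w => S.g w j m) z + S.der (vI j γ) (fun w => S.g w k m) z
      - S.der (vI m γ) (fun w => S.g w j k) z)

/-- The coefficients `Γ^D_{AB}`, `∇_{X_B} X_A = Γ^D_{AB} X_D`, of the Cartan canonical connection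
`(H^γ_{αβ}, G^k_{jγ}, L^k_{ij}, C^{i(γ)}_{j(k)})`, which is `h`-normal: it preserves the splitting,
and on the vertical part it is the tensor product of its spatial part with the dual of its temporal
part. -/
def conn : Idx p n → Idx p n → Idx p n → Coords p n → ℝ
  | .inl γ, .inl α, .inl β => fun z => christoffel S.h γ α β z.1
  | .inr (.inl k), .inr (.inl j), .inl γ => fun z => S.cG k j γ z
  | .inr (.inl k), .inr (.inl j), .inr (.inl i) => fun z => S.cL k j i z
  | .inr (.inl k), .inr (.inl j), .inr (.inr (m, γ)) => fun z => S.cC k j m γ z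
  | .inr (.inr (k, β)), .inr (.inr (i, α)), .inl γ => fun z =>
      (if α = β then S.cG k i γ z else 0) - (if k = i then christoffel S.h α β γ z.1 else 0)
  | .inr (.inr (k, β)), .inr (.inr (i, α)), .inr (.inl j) => fun z =>
      if α = β then S.cL k i j z else 0
  | .inr (.inr (k, β)), .inr (.inr (i, α)), .inr (.inr (m, γ)) => fun z =>
      if α = β then S.cC k i m γ z else 0
  | _, _, _ => fun _ => 0

/-- The covariant derivative `∇_X Y` of the Cartan canonical connection. -/
def cov (X Y : Coords p n → Coords p n) (z : Coords p n) : Coords p n :=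
  ∑ D, (fderiv ℝ (fun w => S.coframe D w (Y w)) z (X z)
    + ∑ A, ∑ B, S.conn D A B z * S.coframe A z (Y z) * S.coframe B z (X z)) • S.frame D z

/-- The curvature `R(X, Y) Z = ∇_X ∇_Y Z - ∇_Y ∇_X Z - ∇_{[X, Y]} Z`. -/
def curv (X Y Z : Coords p n → Coords p n) (z : Coords p n) : Coords p n :=
  S.cov X (S.cov Y Z) z - S.cov Y (S.cov X Z) z - S.cov (VectorField.lieBracket ℝ X Y) Z z

/-- The components `R_{AB} = R^D_{ABD}` of the Ricci d-tensor `Ric(CΓ)`, where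
`R(X_C, X_B) X_A = R^D_{ABC} X_D`. -/
def Ric (A B : Idx p n) (z : Coords p n) : ℝ :=
  ∑ D, S.coframe D z (S.curv (S.frame D) (S.frame B) (S.frame A) z)

/-- The scalar curvature `Sc(CΓ) = G^{AB} R_{AB}`. -/
def Sc (z : Coords p n) : ℝ := ∑ A, ∑ B, S.GUp A B z * S.Ric A B z

/-! #### Derivatives of the conformal function -/

/-- `σ_i = δσ/δx^i`. -/
def σx (i : Fin n) (z : Coords p n) : ℝ := S.der (xI p i) S.σ z

/-- `σ^{(α)}_{(i)} = ∂σ/∂x^i_α`. -/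
def σv (i : Fin n) (α : Fin p) (z : Coords p n) : ℝ := S.der (vI i α) S.σ z

/-- `σ^{iα} = φ^{im} σ^{(α)}_{(m)}`. -/
def σvUp (i : Fin n) (α : Fin p) (z : Coords p n) : ℝ := ∑ m, S.φUp z i m * S.σv m α z

/-- `σ_{jk} = σ_{j‖k} - σ_j σ_k + (1/2) φ_{jk} <σ,σ>`, with the Berwald derivative
`σ_{j‖k} = δσ_j/δx^k - γ^m_{jk} σ_m`. -/
def σxx (j k : Fin n) (z : Coords p n) : ℝ :=
  (S.der (xI p k) (S.σx j) z - ∑ m, christoffel S.φ m j k z.2.1 * S.σx m z)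
    - S.σx j z * S.σx k z
    + (1 / 2) * S.φLow z j k * ∑ r, ∑ m, S.φUp z r m * S.σx r z * S.σx m z

/-- `<σ> = φ^{rs} σ_{rs}`. -/
def trσ (z : Coords p n) : ℝ := ∑ r, ∑ s, S.φUp z r s * S.σxx r s z

/-- `σ^{(β)(γ)}_{(j)(k)} = ∂σ^{(β)}_{(j)}/∂x^k_γ - σ^{(β)}_{(j)} σ^{(γ)}_{(k)}
+ (1/2) φ_{jk} <σ,σ>^{βγ}`. -/
def σvv (j : Fin n) (β : Fin p) (k : Fin n) (γ : Fin p) (z : Coords p n) : ℝ :=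
  S.der (vI k γ) (S.σv j β) z - S.σv j β z * S.σv k γ z
    + (1 / 2) * S.φLow z j k * ∑ r, ∑ m, S.φUp z r m * S.σv r β z * S.σv m γ z

/-- `<<σ>> = h_{αβ} φ^{rs} σ^{(α)(β)}_{(r)(s)}`. -/
def trtrσ (z : Coords p n) : ℝ :=
  ∑ α, ∑ β, S.hLow z α β * ∑ r, ∑ s, S.φUp z r s * S.σvv r α s β z

/-! #### Curvature scalars, the Einstein equations and the system -/

/-- `H`, the scalar curvature of `h`. -/
def sH (z : Coords p n) : ℝ := scalar S.h z.1

/-- `R = e^{-2σ} φ^{ij} R_{ij}`. -/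
def sR (z : Coords p n) : ℝ :=
  Real.exp (-2 * S.σ z) * ∑ i, ∑ j, S.φUp z i j * S.Ric (xI p i) (xI p j) z

/-- `S = h_{αβ} e^{-2σ} φ^{ij} S^{(α)(β)}_{(i)(j)}`, where `S^{(α)(β)}_{(i)(j)}` is the vertical
part of the Ricci d-tensor. -/
def sS (z : Coords p n) : ℝ :=
  ∑ α, ∑ β, S.hLow z α β * (Real.exp (-2 * S.σ z) *
    ∑ i, ∑ j, S.φUp z i j * S.Ric (vI i α) (vI j β) z)

/-- `ρ_{ij} = (2-n) σ_{ij} - (2-n) <σ> φ_{ij}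
- [φ_{is} r^s_{mjq} + r_{mq} φ_{ij} - r_{mj} φ_{iq}] σ^{qμ} x^m_μ`. -/
def ρ (i j : Fin n) (z : Coords p n) : ℝ :=
  (2 - (n : ℝ)) * S.σxx i j z - (2 - (n : ℝ)) * S.trσ z * S.φLow z i j
    - ∑ m, ∑ q, ((∑ s, S.φLow z i s * riem S.φ s m j q z.2.1)
        + ricci S.φ m q z.2.1 * S.φLow z i j - ricci S.φ m j z.2.1 * S.φLow z i q)
      * ∑ μ, S.σvUp q μ z * z.2.2 m μ

/-- The Einstein equations `Ric(CΓ) - (Sc(CΓ)/2) G = 𝒦 𝒯` at the jet with coordinates `z`;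
`𝒯 A B` are the adapted components of the stress-energy d-tensor. -/
def EinsteinEquations (K : ℝ) (𝒯 : Idx p n → Idx p n → ℝ) (z : Coords p n) : Prop :=
  ∀ A B, S.Ric A B z - S.Sc z / 2 * S.GLow A B z = K * 𝒯 A B

/-- `𝒯̃_{αβ} = 𝒯_{αβ} + (R + S)/(2𝒦) h_{αβ}`. -/
def tT (K : ℝ) (𝒯 : Idx p n → Idx p n → ℝ) (α β : Fin p) (z : Coords p n) : ℝ :=
  𝒯 (tI n α) (tI n β) + (S.sR z + S.sS z) / (2 * K) * S.hLow z α β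

/-- `𝒯̃_{ij} = 𝒯_{ij} + (H + S)/(2𝒦) e^{2σ} φ_{ij}`. -/
def tX (K : ℝ) (𝒯 : Idx p n → Idx p n → ℝ) (i j : Fin n) (z : Coords p n) : ℝ :=
  𝒯 (xI p i) (xI p j) + (S.sH z + S.sS z) / (2 * K) * (Real.exp (2 * S.σ z) * S.φLow z i j)

/-- `𝒯̃^{(α)(β)}_{(i)(j)} = 𝒯^{(α)(β)}_{(i)(j)} + (H + R)/(2𝒦) h^{αβ} e^{2σ} φ_{ij}`. -/
def tV (K : ℝ) (𝒯 : Idx p n → Idx p n → ℝ) (i : Fin n) (α : Fin p) (j : Fin n) (β : Fin p)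
    (z : Coords p n) : ℝ :=
  𝒯 (vI i α) (vI j β)
    + (S.sH z + S.sR z) / (2 * K) * (S.hUp z α β * Real.exp (2 * S.σ z) * S.φLow z i j)

/-- The system `(E'_1)` at the jet with coordinates `z`. -/
def SystemE1 (K : ℝ) (𝒯 : Idx p n → Idx p n → ℝ) (z : Coords p n) : Prop :=
  (∀ α β : Fin p,
    ricci S.h α β z.1 - S.sH z / 2 * S.hLow z α β = K * S.tT K 𝒯 α β z) ∧
  (∀ i j : Fin n,
    ricci S.φ i j z.2.1 - scalar S.φ z.2.1 / 2 * S.φLow z i j + S.ρ i j z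
      = K * S.tX K 𝒯 i j z) ∧
  (∀ (i : Fin n) (α : Fin p) (j : Fin n) (β : Fin p),
    S.Ric (vI i α) (vI j β) z + ((n : ℝ) - 1) * S.trtrσ z * S.hUp z α β * S.φLow z i j
      = K * S.tV K 𝒯 i α j β z)

/-- The system `(E_2)` at the jet with coordinates `z`. -/
def SystemE2 (K : ℝ) (𝒯 : Idx p n → Idx p n → ℝ) (z : Coords p n) : Prop :=
  (∀ (α : Fin p) (i : Fin n), 0 = 𝒯 (tI n α) (xI p i)) ∧
  (∀ (i : Fin n) (α : Fin p), S.Ric (xI p i) (tI n α) z = K * 𝒯 (xI p i) (tI n α)) ∧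
  (∀ (i : Fin n) (α β : Fin p), S.Ric (vI i α) (tI n β) z = K * 𝒯 (vI i α) (tI n β)) ∧
  (∀ (α : Fin p) (i : Fin n) (β : Fin p), 0 = 𝒯 (tI n α) (vI i β)) ∧
  (∀ (i j : Fin n) (α : Fin p), S.Ric (xI p i) (vI j α) z = K * 𝒯 (xI p i) (vI j α)) ∧
  (∀ (i : Fin n) (α : Fin p) (j : Fin n),
    S.Ric (vI i α) (xI p j) z = K * 𝒯 (vI i α) (xI p j))

end Space

end JetGR

end

/-! Everything is read in the adapted basis, where the tensor equation splits into nine blocks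
indexed by temporal, spatial and vertical directions. Since `G` is block diagonal, each off-diagonal
block only compares `Ric` with `𝒯`. The blocks (t,x) and (t,v) of `Ric` vanish, because the temporal
coefficients depend on `t` alone and brackets of adapted fields are vertical; with `K ≠ 0` this
gives the two zero equations of `SystemE2`.

The diagonal blocks use `Sc_eq`, the splitting Sc = H + R + S. Each block keeps half of its own
scalar on the left, and the other two move into the modified stress-energy. The temporal block of
`Ric` is the Ricci tensor of h. The other two blocks rest on the conformal form g = e^{2σ}φ: `cL_eq`
and `cC_eq` show that L is the Christoffel symbol of φ plus `conformalTerm` built on δσ/δx, and that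
C is `conformalTerm` built on the vertical derivatives of σ. The Ricci contraction of such a sum is
computed algebraically in `sum_conformalTerm_linear` and `sum_conformalTerm_quadratic`.

What differs from the classical conformal formula is that the horizontal fields do not commute:
their brackets are vertical, with the curvature of φ as coefficients, and they enter the spatial
Ricci block through C (`sum_cC_mul_bracketCoeff`). This produces the curvature bracket in ρ and
accounts for the lack of symmetry of σ_{ij}. The result is `Ric_xI_xI`; its trace `exp_mul_sR` then
gives `Ric_xI_xI_sub_half_sR`. For the vertical block only the trace matters
(`sum_φUp_mul_Ric_vI_vI`, `exp_mul_sS`), since the third equation keeps the Ricci block itself. -/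

noncomputable section

namespace JetGR

/-! ### Components of a semi-Riemannian metric in a chart. -/

section Manifolds

variable {d : ℕ} {X : Type*} [TopologicalSpace X] [ChartedSpace (Eu d) X]

theorem mdifferentiable_symm_of_mem_maximalAtlas {e : OpenPartialHomeomorph X (Eu d)}
    (he : e ∈ IsManifold.maximalAtlas (𝓡 d) ∞ X) :
    e.symm.MDifferentiable (𝓡 d) (𝓡 d) :=
  ⟨(contMDiffOn_symm_of_mem_maximalAtlas he).mdifferentiableOn (by simp),
    (contMDiffOn_of_mem_maximalAtlas he).mdifferentiableOn (by simp)⟩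

theorem SemiRiemannianMetric.components_isSymm (g : SemiRiemannianMetric d X)
    (e : OpenPartialHomeomorph X (Eu d)) (ξ : Eu d) : (g.components e ξ).IsSymm := by
  ext i j
  exact g.symm _ _ _

theorem mfderiv_symm_eq_sum_coordVec (e : OpenPartialHomeomorph X (Eu d)) (ξ v : Eu d) :
    (mfderiv (𝓡 d) (𝓡 d) e.symm ξ v : TangentSpace (𝓡 d) (e.symm ξ))
      = ∑ i, v i • coordVec e ξ i := by
  have hv : v = ∑ i, v i • (EuclideanSpace.single i (1 : ℝ) : Eu d) := by
    ext j
    simp [Pi.single_apply]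
  let D : Eu d →ₗ[ℝ] TangentSpace (𝓡 d) (e.symm ξ) :=
    (mfderiv (𝓡 d) (𝓡 d) e.symm ξ).toLinearMap
  change D v = ∑ i, v i • D (EuclideanSpace.single i (1 : ℝ))
  conv_lhs => rw [hv]
  simp only [map_sum, map_smul]

/-- A kernel vector v of the component matrix gives the tangent vector v^i ∂/∂x^i in the radical of
the form, because the coordinate vectors span. Nondegeneracy kills that vector, and bijectivity of
the derivative of the inverse chart kills v. -/
theorem SemiRiemannianMetric.isUnit_det_components (g : SemiRiemannianMetric d X)
    {e : OpenPartialHomeomorph X (Eu d)} (he : e ∈ IsManifold.maximalAtlas (𝓡 d) ∞ X)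
    {ξ : Eu d} (hξ : ξ ∈ e.target) : IsUnit (g.components e ξ).det := by
  rw [isUnit_iff_ne_zero]
  intro h0
  obtain ⟨v, hv, hgv⟩ := Matrix.exists_mulVec_eq_zero_iff.2 h0
  apply hv
  have hbij := (mdifferentiable_symm_of_mem_maximalAtlas he).mfderiv_bijective (x := ξ) (by simpa)
  have hzero : (mfderiv (𝓡 d) (𝓡 d) e.symm ξ (WithLp.toLp 2 v : Eu d) :
      TangentSpace (𝓡 d) (e.symm ξ)) = 0 := by
    apply g.nondegenerate
    intro w
    rw [g.symm]
    obtain ⟨u, rfl⟩ := hbij.2 w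
    erw [mfderiv_symm_eq_sum_coordVec, mfderiv_symm_eq_sum_coordVec]
    simp only [map_sum, map_smul, LinearMap.sum_apply, LinearMap.smul_apply]
    simp only [Finset.smul_sum]
    rw [Finset.sum_comm]
    refine Finset.sum_eq_zero fun i _ => ?_
    have := congrFun hgv i
    simp only [Matrix.mulVec, dotProduct, SemiRiemannianMetric.components, Matrix.of_apply,
      Pi.zero_apply] at this
    -- The target 0 is rewritten as u_i times the i-th entry of the matrix applied to v, so that
    -- both sides are sums over j.
    rw [← mul_zero ((show Eu d from u) i), ← this, Finset.mul_sum]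
    refine Finset.sum_congr rfl fun j _ => ?_
    simp only [smul_eq_mul]
    ring
  have := hbij.1 (a₂ := (0 : Eu d)) (hzero.trans (ContinuousLinearMap.map_zero _).symm)
  ext i
  exact congrArg (fun w : Eu d => w i) this

end Manifolds


/-! ### The connection and its curvature in the adapted basis. -/

namespace Space

variable {p n : ℕ} (S : Space p n)

theorem coframe_add (D : Idx p n) (z v w : Coords p n) :
    S.coframe D z (v + w) = S.coframe D z v + S.coframe D z w := by
  rcases D with α | i | ⟨i, α⟩
  · simp [coframe]
  · simp [coframe]
  · simp only [coframe, Prod.fst_add, Prod.snd_add, Pi.add_apply, PiLp.add_apply, mul_add,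
      Finset.sum_add_distrib]
    ring

theorem coframe_smul (D : Idx p n) (z v : Coords p n) (c : ℝ) :
    S.coframe D z (c • v) = c * S.coframe D z v := by
  rcases D with α | i | ⟨i, α⟩
  · simp [coframe]
  · simp [coframe]
  · simp only [coframe, Prod.smul_fst, Prod.smul_snd, Pi.smul_apply, PiLp.smul_apply, smul_eq_mul,
      mul_left_comm _ c, ← Finset.mul_sum]
    ring

/-- The adapted covectors as linear forms. -/
def coframeₗ (D : Idx p n) (z : Coords p n) : Coords p n →ₗ[ℝ] ℝ where
  toFun := S.coframe D z
  map_add' := S.coframe_add D z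
  map_smul' c v := S.coframe_smul D z v c

theorem coframe_sub (D : Idx p n) (z v w : Coords p n) :
    S.coframe D z (v - w) = S.coframe D z v - S.coframe D z w :=
  map_sub (S.coframeₗ D z) v w

theorem coframe_sum_smul {ι : Type*} (s : Finset ι) (D : Idx p n) (z : Coords p n) (c : ι → ℝ)
    (v : ι → Coords p n) :
    S.coframe D z (∑ a ∈ s, c a • v a) = ∑ a ∈ s, c a * S.coframe D z (v a) := by
  change S.coframeₗ D z _ = _
  simp only [map_sum, map_smul, smul_eq_mul]
  rfl

/-- The adapted basis and cobasis are dual to each other. -/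
theorem coframe_frame (D A : Idx p n) (z : Coords p n) :
    S.coframe D z (S.frame A z) = if D = A then 1 else 0 := by
  rcases D with α | i | ⟨i, α⟩ <;> rcases A with β | j | ⟨j, β⟩ <;>
    simp [coframe, frame, Pi.single_apply]
  split_ifs <;> simp_all

theorem coframe_sum_frame (D : Idx p n) (z : Coords p n) (c : Idx p n → ℝ) :
    S.coframe D z (∑ A, c A • S.frame A z) = c D := by
  rw [coframe_sum_smul]
  simp only [coframe_frame, mul_ite, mul_one, mul_zero, Finset.sum_ite_eq, Finset.mem_univ, if_true]

theorem coframe_cov (D : Idx p n) (X Y : Coords p n → Coords p n) (z : Coords p n) :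
    S.coframe D z (S.cov X Y z) = fderiv ℝ (fun w => S.coframe D w (Y w)) z (X z)
      + ∑ A, ∑ B, S.conn D A B z * S.coframe A z (Y z) * S.coframe B z (X z) :=
  S.coframe_sum_frame D z _

theorem coframe_cov_frame (D A : Idx p n) (X : Coords p n → Coords p n) (z : Coords p n) :
    S.coframe D z (S.cov X (S.frame A) z) = ∑ B, S.conn D A B z * S.coframe B z (X z) := by
  rw [coframe_cov]
  simp [coframe_frame]

theorem coframe_cov_frame_frame (D A B : Idx p n) (z : Coords p n) :
    S.coframe D z (S.cov (S.frame B) (S.frame A) z) = S.conn D A B z := by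
  simp [coframe_cov_frame, coframe_frame]

/-- The frame components of the inner derivative are the functions Γ^D_{AB}; the outer one
differentiates them and adds its own connection term. -/
theorem coframe_cov_cov_frame (D A B C : Idx p n) (z : Coords p n) :
    S.coframe D z (S.cov (S.frame C) (S.cov (S.frame B) (S.frame A)) z)
      = S.der C (S.conn D A B) z + ∑ E, S.conn E A B z * S.conn D E C z := by
  rw [coframe_cov]
  simp only [coframe_cov_frame_frame, coframe_frame, der]
  simp [mul_comm]

/-- The structure functions of the adapted basis: `[X_C, X_B] = c^E_{CB} X_E`. -/
def bracketCoeff (E C B : Idx p n) (z : Coords p n) : ℝ :=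
  S.coframe E z (VectorField.lieBracket ℝ (S.frame C) (S.frame B) z)

/-- The components of the curvature of the Cartan connection in the adapted basis. -/
theorem coframe_curv_frame (D A B C : Idx p n) (z : Coords p n) :
    S.coframe D z (S.curv (S.frame C) (S.frame B) (S.frame A) z)
      = S.der C (S.conn D A B) z - S.der B (S.conn D A C) z
        + ∑ E, (S.conn E A B z * S.conn D E C z - S.conn E A C z * S.conn D E B z)
        - ∑ E, S.conn D A E z * S.bracketCoeff E C B z := by
  rw [curv, coframe_sub, coframe_sub, coframe_cov_cov_frame, coframe_cov_cov_frame,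
    coframe_cov_frame, Finset.sum_sub_distrib]
  simp only [bracketCoeff]
  ring

end Space

/-! ### Smoothness of inverse matrices and Christoffel symbols. -/

section Smoothness

theorem contDiffOn_det {E ι : Type*} [NormedAddCommGroup E] [NormedSpace ℝ E] [Fintype ι]
    [DecidableEq ι] {g : E → Matrix ι ι ℝ} {V : Set E}
    (hg : ∀ i j, ContDiffOn ℝ ∞ (fun x => g x i j) V) :
    ContDiffOn ℝ ∞ (fun x => (g x).det) V := by
  simp only [Matrix.det_apply, Units.smul_def, zsmul_eq_mul]
  exact ContDiffOn.sum fun τ _ => contDiffOn_const.mul (contDiffOn_prod fun i _ => hg _ _)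

/-- Cramer's rule: an entry of the inverse is a cofactor over the determinant, and the cofactor is
the determinant of the matrix with one row made constant. -/
theorem contDiffOn_matrix_inv {E ι : Type*} [NormedAddCommGroup E] [NormedSpace ℝ E] [Fintype ι]
    [DecidableEq ι] {g : E → Matrix ι ι ℝ} {V : Set E}
    (hg : ∀ i j, ContDiffOn ℝ ∞ (fun x => g x i j) V) (hdet : ∀ x ∈ V, IsUnit (g x).det)
    (i j : ι) : ContDiffOn ℝ ∞ (fun x => (g x)⁻¹ i j) V := by
  simp only [Matrix.inv_def, Ring.inverse_eq_inv', Matrix.smul_apply, smul_eq_mul,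
    Matrix.adjugate_apply]
  refine ((contDiffOn_det hg).inv fun x hx => (hdet x hx).ne_zero).mul (contDiffOn_det ?_)
  intro k l
  by_cases hk : k = j
  · subst hk
    simpa using contDiffOn_const
  · simpa [Matrix.updateRow_ne hk] using hg k l

variable {d : ℕ}

theorem contDiffOn_pd {f : Eu d → ℝ} {V : Set (Eu d)} (hV : IsOpen V)
    (hf : ContDiffOn ℝ ∞ f V) (i : Fin d) : ContDiffOn ℝ ∞ (pd f i) V :=
  (hf.fderiv_of_isOpen hV (by simp)).clm_apply contDiffOn_const

theorem contDiffOn_christoffel {g : Eu d → Matrix (Fin d) (Fin d) ℝ} {V : Set (Eu d)}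
    (hV : IsOpen V) (hg : ∀ i j, ContDiffOn ℝ ∞ (fun x => g x i j) V)
    (hdet : ∀ x ∈ V, IsUnit (g x).det) (k i j : Fin d) :
    ContDiffOn ℝ ∞ (christoffel g k i j) V := by
  unfold christoffel
  exact contDiffOn_const.mul (ContDiffOn.sum fun m _ => (contDiffOn_matrix_inv hg hdet k m).mul
    (((contDiffOn_pd hV (hg j m) i).add (contDiffOn_pd hV (hg i m) j)).sub
      (contDiffOn_pd hV (hg i j) m)))

end Smoothness

/-! ### Coordinate domains on which the data are regular. -/

namespace Space

variable {p n : ℕ} (S : Space p n)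

/-- The part of the coordinate space of jets over two coordinate domains. -/
def jetsOver (U : Set (Eu p)) (V : Set (Eu n)) : Set (Coords p n) := {z | z.1 ∈ U ∧ z.2.1 ∈ V}

/-- The coordinate expressions are smooth, symmetric and nondegenerate over two open sets. -/
structure RegularOn (U : Set (Eu p)) (V : Set (Eu n)) : Prop where
  isOpen_left : IsOpen U
  isOpen_right : IsOpen V
  contDiffOn_h : ∀ α β, ContDiffOn ℝ ∞ (fun t => S.h t α β) U
  contDiffOn_φ : ∀ i j, ContDiffOn ℝ ∞ (fun x => S.φ x i j) V
  isUnit_det_h : ∀ t ∈ U, IsUnit (S.h t).det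
  isUnit_det_φ : ∀ x ∈ V, IsUnit (S.φ x).det
  isSymm_φ : ∀ x, (S.φ x).IsSymm
  contDiffOn_σ : ContDiffOn ℝ ∞ S.σ (jetsOver U V)

variable {S} {U : Set (Eu p)} {V : Set (Eu n)} {z : Coords p n}

theorem contDiffOn_comp_left {f : Eu p → ℝ} (hf : ContDiffOn ℝ ∞ f U) :
    ContDiffOn ℝ ∞ (fun z : Coords p n => f z.1) (jetsOver U V) :=
  hf.comp contDiff_fst.contDiffOn fun _ hz => hz.1

theorem contDiffOn_comp_right {f : Eu n → ℝ} (hf : ContDiffOn ℝ ∞ f V) :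
    ContDiffOn ℝ ∞ (fun z : Coords p n => f z.2.1) (jetsOver U V) :=
  hf.comp (contDiff_fst.comp contDiff_snd).contDiffOn fun _ hz => hz.2

namespace RegularOn

variable (hS : S.RegularOn U V)
include hS

theorem isOpen_over : IsOpen (jetsOver (p := p) (n := n) U V) :=
  (hS.isOpen_left.preimage continuous_fst).inter
    (hS.isOpen_right.preimage (continuous_fst.comp continuous_snd))

theorem contDiffAt_σ (hz : z ∈ jetsOver U V) : ContDiffAt ℝ ∞ S.σ z :=
  hS.contDiffOn_σ.contDiffAt (hS.isOpen_over.mem_nhds hz)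

theorem differentiableAt_σ (hz : z ∈ jetsOver U V) : DifferentiableAt ℝ S.σ z :=
  (hS.contDiffAt_σ hz).differentiableAt (by simp)

theorem differentiableAt_of_contDiffOn {E : Type*} [NormedAddCommGroup E] [NormedSpace ℝ E]
    {f : Coords p n → E} (hf : ContDiffOn ℝ ∞ f (jetsOver U V)) (hz : z ∈ jetsOver U V) :
    DifferentiableAt ℝ f z :=
  (hf.contDiffAt (hS.isOpen_over.mem_nhds hz)).differentiableAt (by simp)

theorem contDiffOn_christoffel_h (γ α β : Fin p) :
    ContDiffOn ℝ ∞ (christoffel S.h γ α β) U :=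
  contDiffOn_christoffel hS.isOpen_left hS.contDiffOn_h hS.isUnit_det_h γ α β

theorem contDiffOn_christoffel_φ (k i j : Fin n) :
    ContDiffOn ℝ ∞ (christoffel S.φ k i j) V :=
  contDiffOn_christoffel hS.isOpen_right hS.contDiffOn_φ hS.isUnit_det_φ k i j

theorem contDiffOn_φLow (i j : Fin n) : ContDiffOn ℝ ∞ (fun z => S.φLow z i j) (jetsOver U V) :=
  contDiffOn_comp_right (hS.contDiffOn_φ i j)

theorem contDiffOn_φUp (i j : Fin n) : ContDiffOn ℝ ∞ (fun z => S.φUp z i j) (jetsOver U V) :=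
  contDiffOn_comp_right
    (contDiffOn_matrix_inv hS.contDiffOn_φ hS.isUnit_det_φ i j)

theorem contDiffOn_nlM (i : Fin n) (α β : Fin p) : ContDiffOn ℝ ∞ (S.nlM i α β) (jetsOver U V) := by
  unfold nlM
  exact (ContDiffOn.sum fun μ _ => (contDiffOn_comp_left (hS.contDiffOn_christoffel_h μ α β)).mul
    (ContDiff.contDiffOn (by fun_prop))).neg

theorem contDiffOn_nlN (i : Fin n) (α : Fin p) (j : Fin n) :
    ContDiffOn ℝ ∞ (S.nlN i α j) (jetsOver U V) := by
  unfold nlN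
  exact ContDiffOn.sum fun m _ => (contDiffOn_comp_right (hS.contDiffOn_christoffel_φ i j m)).mul
    (ContDiff.contDiffOn (by fun_prop))

theorem contDiffOn_frame (A : Idx p n) : ContDiffOn ℝ ∞ (S.frame A) (jetsOver U V) := by
  rcases A with α | i | ⟨i, α⟩
  · exact contDiffOn_const.prodMk (contDiffOn_const.prodMk
      (contDiffOn_pi.2 fun j => contDiffOn_pi.2 fun β => (hS.contDiffOn_nlM j β α).neg))
  · exact contDiffOn_const.prodMk (contDiffOn_const.prodMk
      (contDiffOn_pi.2 fun j => contDiffOn_pi.2 fun β => (hS.contDiffOn_nlN j β i).neg))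
  · exact contDiffOn_const

theorem contDiffOn_der (A : Idx p n) {f : Coords p n → ℝ} (hf : ContDiffOn ℝ ∞ f (jetsOver U V)) :
    ContDiffOn ℝ ∞ (S.der A f) (jetsOver U V) :=
  (hf.fderiv_of_isOpen hS.isOpen_over (by simp)).clm_apply (hS.contDiffOn_frame A)

/-- Since the domain is open, identities valid on it may be differentiated. This is how the formulas
for L and C pass to their derivatives. -/
theorem der_congr (A : Idx p n) {f g : Coords p n → ℝ} (hfg : Set.EqOn f g (jetsOver U V))
    (hz : z ∈ jetsOver U V) : S.der A f z = S.der A g z := by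
  unfold der
  rw [(hfg.eventuallyEq_of_mem (hS.isOpen_over.mem_nhds hz)).fderiv_eq]

end RegularOn

variable (S)

/-! ### Adapted basis fields as derivations. -/

section Derivations

variable {f g : Coords p n → ℝ} (A : Idx p n)

theorem der_const (c : ℝ) : S.der A (fun _ => c) z = 0 := by
  simp [der]

theorem der_add (hf : DifferentiableAt ℝ f z) (hg : DifferentiableAt ℝ g z) :
    S.der A (fun w => f w + g w) z = S.der A f z + S.der A g z := by
  simp only [der]
  rw [fderiv_fun_add hf hg]
  rfl

theorem der_sub (hf : DifferentiableAt ℝ f z) (hg : DifferentiableAt ℝ g z) :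
    S.der A (fun w => f w - g w) z = S.der A f z - S.der A g z := by
  simp only [der]
  rw [fderiv_fun_sub hf hg]
  rfl

theorem der_neg : S.der A (fun w => - f w) z = - S.der A f z := by
  simp only [der]
  rw [fderiv_fun_neg]
  rfl

theorem der_mul (hf : DifferentiableAt ℝ f z) (hg : DifferentiableAt ℝ g z) :
    S.der A (fun w => f w * g w) z = S.der A f z * g z + f z * S.der A g z := by
  simp only [der]
  rw [fderiv_fun_mul hf hg]
  simp only [add_apply, smul_apply, smul_eq_mul]
  ring

theorem der_sum {ι : Type*} {s : Finset ι} {F : ι → Coords p n → ℝ}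
    (hF : ∀ i ∈ s, DifferentiableAt ℝ (F i) z) :
    S.der A (fun w => ∑ i ∈ s, F i w) z = ∑ i ∈ s, S.der A (F i) z := by
  simp only [der]
  rw [fderiv_fun_sum hF]
  simp

theorem der_exp_two_mul (hf : DifferentiableAt ℝ f z) :
    S.der A (fun w => Real.exp (2 * f w)) z = Real.exp (2 * f z) * (2 * S.der A f z) := by
  simp only [der]
  rw [fderiv_exp (hf.const_mul 2), fderiv_const_mul hf]
  simp

theorem der_comp_left {f : Eu p → ℝ} (hf : DifferentiableAt ℝ f z.1) :
    S.der A (fun w => f w.1) z = fderiv ℝ f z.1 (S.frame A z).1 := by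
  have := hf.hasFDerivAt.comp z (hasFDerivAt_fst (𝕜 := ℝ) (p := z))
  simp only [der]
  rw [HasFDerivAt.fderiv (f := fun w : Coords p n => f w.1) this]
  rfl

theorem der_comp_right {f : Eu n → ℝ} (hf : DifferentiableAt ℝ f z.2.1) :
    S.der A (fun w => f w.2.1) z = fderiv ℝ f z.2.1 (S.frame A z).2.1 := by
  have h2 : HasFDerivAt (fun w : Coords p n => w.2.1) _ z :=
    (hasFDerivAt_fst (𝕜 := ℝ) (p := z.2)).comp z (hasFDerivAt_snd (𝕜 := ℝ) (p := z))
  have := hf.hasFDerivAt.comp z h2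
  simp only [der]
  rw [HasFDerivAt.fderiv (f := fun w : Coords p n => f w.2.1) this]
  rfl

theorem der_coord (i : Fin n) (α : Fin p) :
    S.der A (fun w => w.2.2 i α) z = (S.frame A z).2.2 i α := by
  let ℓ : Coords p n →L[ℝ] ℝ := (ContinuousLinearMap.proj α).comp
    ((ContinuousLinearMap.proj (R := ℝ) (φ := fun _ : Fin n => Fin p → ℝ) i).comp
      ((ContinuousLinearMap.snd ℝ _ _).comp (ContinuousLinearMap.snd ℝ _ _)))
  change fderiv ℝ ℓ z _ = _
  rw [ContinuousLinearMap.fderiv]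
  rfl

end Derivations

/-! ### Brackets of the adapted basis fields. -/

namespace RegularOn

variable {S} (hS : S.RegularOn U V) (hz : z ∈ jetsOver U V)
include hS hz

/-- The temporal part of every adapted field is constant. The spatial part is too, so all brackets
are vertical. -/
theorem bracketCoeff_tI (α : Fin p) (C B : Idx p n) : S.bracketCoeff (tI n α) C B z = 0 := by
  have key : ∀ A v, (fderiv ℝ (S.frame A) z v).1 = 0 := by
    intro A v
    have hd := hS.differentiableAt_of_contDiffOn (hS.contDiffOn_frame A) hz
    have h1 := (hasFDerivAt_fst (𝕜 := ℝ) (p := S.frame A z)).comp z hd.hasFDerivAt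
    have h2 : HasFDerivAt (Prod.fst ∘ S.frame A) (0 : Coords p n →L[ℝ] Eu p) z := by
      rcases A with α | i | ⟨i, α⟩ <;> exact hasFDerivAt_const _ _
    exact congrArg (fun L => L v) (h1.unique h2)
  simp [bracketCoeff, coframe, VectorField.lieBracket, key]

theorem bracketCoeff_xI (i : Fin n) (C B : Idx p n) : S.bracketCoeff (xI p i) C B z = 0 := by
  have key : ∀ A v, (fderiv ℝ (S.frame A) z v).2.1 = 0 := by
    intro A v
    have hd := hS.differentiableAt_of_contDiffOn (hS.contDiffOn_frame A) hz
    have h1 := (hasFDerivAt_fst (𝕜 := ℝ) (p := (S.frame A z).2)).comp z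
      ((hasFDerivAt_snd (𝕜 := ℝ) (p := S.frame A z)).comp z hd.hasFDerivAt)
    have h2 : HasFDerivAt (Prod.fst ∘ Prod.snd ∘ S.frame A) (0 : Coords p n →L[ℝ] Eu n) z := by
      rcases A with α | i | ⟨i, α⟩ <;> exact hasFDerivAt_const _ _
    exact congrArg (fun L => L v) (h1.unique h2)
  simp [bracketCoeff, coframe, VectorField.lieBracket, key]

theorem lieBracket_frame_fst (C B : Idx p n) :
    (VectorField.lieBracket ℝ (S.frame C) (S.frame B) z).1 = 0 := by
  ext α
  exact hS.bracketCoeff_tI hz α C B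

theorem lieBracket_frame_snd_fst (C B : Idx p n) :
    (VectorField.lieBracket ℝ (S.frame C) (S.frame B) z).2.1 = 0 := by
  ext i
  exact hS.bracketCoeff_xI hz i C B

/-- As the bracket is vertical, the corrections by M and N in δx^i_α vanish on it, and only
derivatives of the fibre components of the frame remain. -/
theorem bracketCoeff_vI (i : Fin n) (α : Fin p) (C B : Idx p n) :
    S.bracketCoeff (vI i α) C B z = S.der C (fun w => (S.frame B w).2.2 i α) z
      - S.der B (fun w => (S.frame C w).2.2 i α) z := by
  have key : ∀ A v, (fderiv ℝ (S.frame A) z v).2.2 i α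
      = fderiv ℝ (fun w => (S.frame A w).2.2 i α) z v := by
    intro A v
    have hd := hS.differentiableAt_of_contDiffOn (hS.contDiffOn_frame A) hz
    let ℓ : Coords p n →L[ℝ] ℝ := (ContinuousLinearMap.proj α).comp
      ((ContinuousLinearMap.proj (R := ℝ) (φ := fun _ : Fin n => Fin p → ℝ) i).comp
        ((ContinuousLinearMap.snd ℝ _ _).comp (ContinuousLinearMap.snd ℝ _ _)))
    have h1 := ℓ.hasFDerivAt.comp z hd.hasFDerivAt
    rw [HasFDerivAt.fderiv (f := fun w => (S.frame A w).2.2 i α) h1]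
    rfl
  have h1 := hS.lieBracket_frame_fst hz C B
  have h2 := hS.lieBracket_frame_snd_fst hz C B
  simp only [bracketCoeff, coframe, h1, h2, PiLp.zero_apply, mul_zero, Finset.sum_const_zero,
    add_zero]
  simp only [VectorField.lieBracket, der, Prod.snd_sub, Pi.sub_apply, key]

theorem fderiv_lieBracket_frame (C B : Idx p n) (f : Coords p n → ℝ) :
    fderiv ℝ f z (VectorField.lieBracket ℝ (S.frame C) (S.frame B) z)
      = ∑ i, ∑ α, S.bracketCoeff (vI i α) C B z * S.der (vI i α) f z := by
  have h1 := hS.lieBracket_frame_fst hz C B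
  have h2 := hS.lieBracket_frame_snd_fst hz C B
  simp only [bracketCoeff]
  generalize VectorField.lieBracket ℝ (S.frame C) (S.frame B) z = b at h1 h2 ⊢
  have : b
      = ∑ i, ∑ α, S.coframe (vI i α) z b • S.frame (vI i α) z := by
    refine Prod.ext ?_ (Prod.ext ?_ ?_)
    · simp [h1, frame, Prod.fst_sum]
    · simp [h2, frame, Prod.fst_sum, Prod.snd_sum]
    · ext j β
      simp [coframe, h1, h2, frame, Prod.snd_sum, Finset.sum_apply, Pi.single_apply, apply_ite, ite_apply]
  conv_lhs => rw [this]
  simp only [map_sum, map_smul, smul_eq_mul, der]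

/-- `X_C X_B f - X_B X_C f = [X_C, X_B] f`. -/
theorem der_der_sub_der_der (C B : Idx p n) {f : Coords p n → ℝ}
    (hf : ContDiffOn ℝ ∞ f (jetsOver U V)) :
    S.der C (S.der B f) z - S.der B (S.der C f) z
      = ∑ i, ∑ α, S.bracketCoeff (vI i α) C B z * S.der (vI i α) f z := by
  have hfz := hf.contDiffAt (hS.isOpen_over.mem_nhds hz)
  have hdf : DifferentiableAt ℝ (fderiv ℝ f) z :=
    (hfz.fderiv_right (m := 1) (WithTop.coe_le_coe.2 (le_top : (1 + 1 : ℕ∞) ≤ ⊤))).differentiableAt (by simp)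
  have hd := fun A => hS.differentiableAt_of_contDiffOn (hS.contDiffOn_frame A) hz
  -- The product rule splits the second derivative into a Hessian term and a first-order term. The
  -- Hessian cancels by symmetry; the first-order terms form the bracket.
  have key : ∀ C B, S.der C (S.der B f) z = fderiv ℝ (fderiv ℝ f) z (S.frame C z) (S.frame B z)
      + fderiv ℝ f z (fderiv ℝ (S.frame B) z (S.frame C z)) := by
    intro C B
    change fderiv ℝ (fun w => fderiv ℝ f w (S.frame B w)) z (S.frame C z) = _
    rw [fderiv_clm_apply hdf (hd B)]
    simp [add_comm]
  have hsymm : IsSymmSndFDerivAt ℝ f z := hfz.isSymmSndFDerivAt (by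
    rw [minSmoothness_of_isRCLikeNormedField]
    exact WithTop.coe_le_coe.2 (le_top : (2 : ℕ∞) ≤ ⊤))
  rw [key, key, hsymm.eq, ← hS.fderiv_lieBracket_frame hz, VectorField.lieBracket, map_sub]
  ring

end RegularOn

end Space

/-! ### Algebra of the conformal change of Christoffel symbols. -/

section ConformalAlgebra

variable {n : ℕ}

/-- The change `δ^k_i s_j + δ^k_j s_i - φ_{ij} s^k` of the Christoffel symbols under a conformal
change of the metric. -/
def conformalTerm (φ : Fin n → Fin n → ℝ) (s r : Fin n → ℝ) (k i j : Fin n) : ℝ :=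
  (if k = i then s j else 0) + (if k = j then s i else 0) - φ i j * r k

variable {φ : Fin n → Fin n → ℝ} (hφ : ∀ i j, φ i j = φ j i)

theorem sum_conformalTerm_mul (s r c : Fin n → ℝ) (i j : Fin n) :
    ∑ m, conformalTerm φ s r m i j * c m = s j * c i + s i * c j - φ i j * ∑ m, r m * c m := by
  simp only [conformalTerm, add_mul, sub_mul, ite_mul, zero_mul, Finset.sum_add_distrib,
    Finset.sum_sub_distrib, Finset.sum_ite_eq', Finset.mem_univ, if_true, mul_assoc,
    Finset.mul_sum]

theorem sum_conformalTerm_right_mul (s r c : Fin n → ℝ) (m i : Fin n) :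
    ∑ k, conformalTerm φ s r m i k * c k
      = (if m = i then ∑ k, s k * c k else 0) + s i * c m - r m * ∑ k, φ i k * c k := by
  simp only [conformalTerm, add_mul, sub_mul, ite_mul, zero_mul, Finset.sum_add_distrib,
    Finset.sum_sub_distrib, Finset.sum_ite_eq, Finset.mem_univ, if_true, Finset.mul_sum]
  congr 1
  · congr 1
    split_ifs <;> simp
  · exact Finset.sum_congr rfl fun k _ => by ring

/-- The two Kronecker deltas give n + 1 copies of u_i, and φ_{ik} v^k removes one. -/
theorem sum_conformalTerm_contract {u v : Fin n → ℝ} (hu : ∀ i, ∑ m, φ i m * v m = u i)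
    (i : Fin n) : ∑ k, conformalTerm φ u v k i k = n * u i := by
  simp only [conformalTerm, Finset.sum_add_distrib, Finset.sum_sub_distrib, if_true, hu,
    Finset.sum_ite_eq', Finset.mem_univ, Finset.sum_const, Finset.card_univ, Fintype.card_fin,
    nsmul_eq_mul]
  ring

include hφ

/-- Two covectors are allowed because the vertical block mixes the derivatives of σ for two fibre
indices α and β. The horizontal block takes both equal. -/
theorem sum_conformalTerm_quadratic {s r u v : Fin n → ℝ} (hs : ∀ i, ∑ m, φ i m * r m = s i)
    (hu : ∀ i, ∑ m, φ i m * v m = u i) (i j : Fin n) :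
    ∑ k, ∑ m, (conformalTerm φ s r m i j * conformalTerm φ u v k m k
        - conformalTerm φ u v m i k * conformalTerm φ s r k m j)
      = ((n : ℝ) - 2) * (s i * u j - φ i j * ∑ k, r k * u k) := by
  -- Both sides are the pairing of r and v under the symmetric form φ.
  have hsym : ∑ k, v k * s k = ∑ k, r k * u k := by
    simp only [← hs, ← hu, Finset.mul_sum]
    rw [Finset.sum_comm]
    refine Finset.sum_congr rfl fun k _ => Finset.sum_congr rfl fun m _ => ?_
    rw [hφ m k]
    ring
  have h1 : ∑ k, ∑ m, conformalTerm φ s r m i j * conformalTerm φ u v k m k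
      = n * (s j * u i + s i * u j - φ i j * ∑ m, r m * u m) := by
    rw [Finset.sum_comm]
    simp only [← Finset.mul_sum, sum_conformalTerm_contract hu]
    rw [← sum_conformalTerm_mul, Finset.mul_sum]
    exact Finset.sum_congr rfl fun m _ => by ring
  have h2 : ∑ k, ∑ m, conformalTerm φ u v m i k * conformalTerm φ s r k m j
      = n * s j * u i + 2 * s i * u j - 2 * φ i j * ∑ k, r k * u k := by
    have key : ∀ m, ∑ k, conformalTerm φ u v m i k * conformalTerm φ s r k m j
        = (if m = i then (s j * u m + s m * u j - φ m j * ∑ k, r k * u k) else 0)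
          + u i * conformalTerm φ s r m m j
          - v m * (s j * φ i m + s m * φ i j - φ m j * ∑ k, r k * φ i k) := by
      intro m
      rw [sum_conformalTerm_right_mul, ← sum_conformalTerm_mul, ← sum_conformalTerm_mul]
      simp only [mul_comm]
    rw [Finset.sum_comm]
    simp only [key]
    have hr : ∑ k, r k * φ i k = s i := by
      rw [← hs]
      exact Finset.sum_congr rfl fun k _ => by ring
    have h3 : ∑ m, conformalTerm φ s r m m j = n * s j := by
      rw [← sum_conformalTerm_contract hs]
      refine Finset.sum_congr rfl fun k _ => ?_
      simp only [conformalTerm, hφ j k]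
      ring
    have h4 : ∑ m, v m * (s j * φ i m + s m * φ i j - φ m j * s i)
        = s j * u i + φ i j * (∑ k, r k * u k) - s i * u j := by
      rw [← hsym, ← hu i, ← hu j]
      simp only [Finset.mul_sum, ← Finset.sum_add_distrib, ← Finset.sum_sub_distrib]
      refine Finset.sum_congr rfl fun k _ => ?_
      rw [hφ k j]
      ring
    simp only [hr, Finset.sum_add_distrib, Finset.sum_sub_distrib, Finset.sum_ite_eq',
      Finset.mem_univ, if_true, ← Finset.mul_sum, h3] at h4 ⊢
    rw [h4]
    ring
  simp only [Finset.sum_sub_distrib, h1, h2]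
  ring

omit hφ in
/-- The part of the conformal change of the Ricci tensor that is linear in `s`. Here
`Ds k a` stands for `∂_k s_a` and `Dr k` for `∂_k s^k`. -/
theorem sum_conformalTerm_linear {γ : Fin n → Fin n → Fin n → ℝ}
    (hγ : ∀ k i j, γ k i j = γ k j i) {s r : Fin n → ℝ} (hs : ∀ i, ∑ m, φ i m * r m = s i)
    (Ds : Fin n → Fin n → ℝ) (Dr : Fin n → ℝ) (i j : Fin n) :
    ∑ k, ((if k = i then Ds k j else 0) + (if k = j then Ds k i else 0)
        - ((∑ m, (γ m k i * φ m j + γ m k j * φ i m)) * r k + φ i j * Dr k))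
      + ∑ k, ∑ m, (conformalTerm φ s r m i j * γ k m k + γ m i j * conformalTerm φ s r k m k
        - conformalTerm φ s r m i k * γ k m j - γ m i k * conformalTerm φ s r k m j)
      = Ds i j + Ds j i + ((n : ℝ) - 2) * ∑ m, γ m i j * s m
        - φ i j * (∑ k, Dr k + ∑ k, ∑ m, γ k k m * r m) := by
  have h1 : ∑ k, ∑ m, conformalTerm φ s r m i j * γ k m k
      = s j * (∑ k, γ k i k) + s i * (∑ k, γ k j k) - φ i j * ∑ k, ∑ m, γ k k m * r m := by
    simp only [sum_conformalTerm_mul, Finset.sum_add_distrib, Finset.sum_sub_distrib,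
      ← Finset.mul_sum]
    congr 2
    refine Finset.sum_congr rfl fun k _ => Finset.sum_congr rfl fun m _ => ?_
    rw [hγ k k m]
    ring
  have h2 : ∑ k, ∑ m, γ m i j * conformalTerm φ s r k m k = n * ∑ m, γ m i j * s m := by
    rw [Finset.sum_comm]
    simp only [← Finset.mul_sum, sum_conformalTerm_contract hs]
    rw [Finset.mul_sum]
    exact Finset.sum_congr rfl fun m _ => by ring
  have h3 : ∑ k, ∑ m, conformalTerm φ s r m i k * γ k m j
      = ∑ k, γ k i j * s k + s i * ∑ k, γ k j k - ∑ k, ∑ m, γ m k j * φ i m * r k := by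
    rw [Finset.sum_comm]
    simp only [sum_conformalTerm_right_mul, Finset.sum_add_distrib, Finset.sum_sub_distrib,
      Finset.sum_ite_eq', Finset.mem_univ, if_true, ← Finset.mul_sum]
    congr 1
    · congr 1
      · exact Finset.sum_congr rfl fun k _ => mul_comm _ _
      · congr 1
        exact Finset.sum_congr rfl fun k _ => hγ _ _ _
    · refine Finset.sum_congr rfl fun k _ => ?_
      rw [Finset.mul_sum]
      exact Finset.sum_congr rfl fun m _ => by ring
  have h4 : ∑ k, ∑ m, γ m i k * conformalTerm φ s r k m j
      = s j * ∑ k, γ k i k + ∑ k, γ k i j * s k - ∑ k, ∑ m, γ m k i * φ m j * r k := by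
    have key : ∀ k m, γ m i k * conformalTerm φ s r k m j
        = (if k = m then s j * γ m i k else 0) + (if k = j then γ m i k * s m else 0)
          - γ m k i * φ m j * r k := by
      intro k m
      simp only [conformalTerm, hγ m k i]
      split_ifs <;> ring
    simp only [key, Finset.sum_add_distrib, Finset.sum_sub_distrib, Finset.sum_ite_eq,
      Finset.mem_univ, if_true, ← Finset.mul_sum]
    congr 2
    rw [Finset.sum_comm]
    simp
  -- The traces of γ in `h1` cancel against `h3` and `h4`. The γφr terms of `h3` and `h4` cancel
  -- those of the first sum, where the derivative of φ is already expressed by metric compatibility.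
  simp only [Finset.sum_add_distrib, Finset.sum_sub_distrib, h1, h2, h3, h4, add_mul,
    Finset.sum_mul, Finset.sum_ite_eq', Finset.mem_univ, if_true, ← Finset.mul_sum]
  ring

end ConformalAlgebra

/-- Symmetry at every point makes this an equality of functions, so it can be used under
derivatives. -/
theorem christoffel_comm {d : ℕ} {g : Eu d → Matrix (Fin d) (Fin d) ℝ}
    (hg : ∀ x, (g x).IsSymm) (k i j : Fin d) : christoffel g k i j = christoffel g k j i := by
  have h : (fun y => g y i j) = fun y => g y j i := funext fun y => (hg y).apply j i
  funext x
  simp only [christoffel, h]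
  congr 1
  exact Finset.sum_congr rfl fun m _ => by ring

/-! ### Ricci components as traces of the connection coefficients. -/

namespace Space

variable {p n : ℕ} {S : Space p n} {U : Set (Eu p)} {V : Set (Eu n)} {z : Coords p n}

namespace RegularOn

variable (hS : S.RegularOn U V) (hz : z ∈ jetsOver U V)
include hS hz

theorem der_left {f : Eu p → ℝ} (hf : ContDiffOn ℝ ∞ f U) :
    (∀ α, S.der (tI n α) (fun w => f w.1) z = pd f α z.1) ∧
    (∀ i, S.der (xI p i) (fun w => f w.1) z = 0) ∧
    (∀ i α, S.der (vI i α) (fun w => f w.1) z = 0) := by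
  have hd : DifferentiableAt ℝ f z.1 :=
    (hf.contDiffAt (hS.isOpen_left.mem_nhds hz.1)).differentiableAt (by simp)
  refine ⟨fun α => ?_, fun i => ?_, fun i α => ?_⟩ <;>
    simp [der_comp_left S _ hd, frame, pd]

theorem der_right {f : Eu n → ℝ} (hf : ContDiffOn ℝ ∞ f V) :
    (∀ i, S.der (xI p i) (fun w => f w.2.1) z = pd f i z.2.1) ∧
    (∀ i α, S.der (vI i α) (fun w => f w.2.1) z = 0) := by
  have hd : DifferentiableAt ℝ f z.2.1 :=
    (hf.contDiffAt (hS.isOpen_right.mem_nhds hz.2)).differentiableAt (by simp)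
  refine ⟨fun i => ?_, fun i α => ?_⟩ <;>
    simp [der_comp_right S _ hd, frame, pd]

/-- The connection preserves the splitting, so only temporal D enter the trace. Temporal
coefficients see only temporal directions, in which brackets have no component. -/
theorem Ric_tI_tI (α β : Fin p) : S.Ric (tI n α) (tI n β) z = ricci S.h α β z.1 := by
  have hder := fun a b c d => (hS.der_left hz (hS.contDiffOn_christoffel_h a b c)).1 d
  have hb := hS.bracketCoeff_tI hz
  simp only [Ric, coframe_curv_frame, Fintype.sum_sum_type, ricci, riem]
  simp [conn, der_const, hder, hb]

theorem Ric_tI_xI (α : Fin p) (i : Fin n) : S.Ric (tI n α) (xI p i) z = 0 := by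
  have hder := fun a b c d => (hS.der_left hz (hS.contDiffOn_christoffel_h a b c)).2.1 d
  have hb := hS.bracketCoeff_tI hz
  simp only [Ric, coframe_curv_frame, Fintype.sum_sum_type]
  simp [conn, der_const, hder, hb]

theorem Ric_tI_vI (α : Fin p) (i : Fin n) (β : Fin p) : S.Ric (tI n α) (vI i β) z = 0 := by
  have hder := fun a b c d e => (hS.der_left hz (hS.contDiffOn_christoffel_h a b c)).2.2 d e
  have hb := hS.bracketCoeff_tI hz
  simp only [Ric, coframe_curv_frame, Fintype.sum_sum_type]
  simp [conn, der_const, hder, hb]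

/-- The classical Ricci expression in L, corrected by C in the direction of the vertical bracket:
here the nonholonomy enters. -/
theorem Ric_xI_xI_eq_sum (i j : Fin n) : S.Ric (xI p i) (xI p j) z
    = ∑ k, (S.der (xI p k) (S.cL k i j) z - S.der (xI p j) (S.cL k i k) z
      + ∑ m, (S.cL m i j z * S.cL k m k z - S.cL m i k z * S.cL k m j z)
      - ∑ m, ∑ μ, S.cC k i m μ z * S.bracketCoeff (vI m μ) (xI p k) (xI p j) z) := by
  have hb := hS.bracketCoeff_tI hz
  have hb' := hS.bracketCoeff_xI hz
  simp only [Ric, coframe_curv_frame, Fintype.sum_sum_type]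
  simp [conn, der_const, hb, hb', Fintype.sum_prod_type]

theorem bracketCoeff_vI_vI (E : Idx p n) (i j : Fin n) (α β : Fin p) :
    S.bracketCoeff E (vI i α) (vI j β) z = 0 := by
  rcases E with γ | k | ⟨k, γ⟩
  · exact hS.bracketCoeff_tI hz _ _ _
  · exact hS.bracketCoeff_xI hz _ _ _
  · rw [hS.bracketCoeff_vI hz]
    simp [frame, der_const]

/-- Vertical fields commute, and the Kronecker delta in the fibre index reduces the trace over D =
(k, γ) to γ = α. -/
theorem Ric_vI_vI_eq_sum (i j : Fin n) (α β : Fin p) : S.Ric (vI i α) (vI j β) z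
    = ∑ k, (S.der (vI k α) (S.cC k i j β) z - S.der (vI j β) (S.cC k i k α) z
      + ∑ m, (S.cC m i j β z * S.cC k m k α z - S.cC m i k α z * S.cC k m j β z)) := by
  have hb := hS.bracketCoeff_vI_vI hz
  have hite : ∀ (A : Idx p n) (c : Prop) [Decidable c] (f : Coords p n → ℝ),
      S.der A (fun w => if c then f w else 0) z = if c then S.der A f z else 0 := by
    intro A c _ f
    split_ifs
    · rfl
    · exact der_const S A 0
  simp only [Ric, coframe_curv_frame, Fintype.sum_sum_type]
  simp [conn, der_const, hb, hite, Fintype.sum_prod_type]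
  simp only [Finset.sum_add_distrib, Finset.sum_sub_distrib, Finset.sum_ite_eq, Finset.mem_univ,
    if_true]

/-- The vertical components `-r^m_{ljk} x^l_μ` of `[δ/δx^k, δ/δx^j]`. -/
theorem bracketCoeff_vI_xI_xI (m : Fin n) (μ : Fin p) (k j : Fin n) :
    S.bracketCoeff (vI m μ) (xI p k) (xI p j) z
      = - ∑ l, riem S.φ m l j k z.2.1 * z.2.2 l μ := by
  have hΓ := fun a b c => christoffel_comm (g := S.φ) hS.isSymm_φ a b c
  have hder := fun a b c d => (hS.der_right hz (hS.contDiffOn_christoffel_φ a b c)).1 d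
  -- δ/δx^k acts on γ by ∂_k and on x^l_μ by -N, which yields the γγ products. Antisymmetrizing in k
  -- and j gives the curvature of φ.
  have key : ∀ k j, S.der (xI p k) (fun w => - S.nlN m μ j w) z
      = - ∑ l, (pd (christoffel S.φ m l j) k z.2.1
          - ∑ s, christoffel S.φ s l k z.2.1 * christoffel S.φ m s j z.2.1) * z.2.2 l μ := by
    intro k j
    have hd : ∀ l, DifferentiableAt ℝ (fun w : Coords p n => christoffel S.φ m j l w.2.1) z :=
      fun l => hS.differentiableAt_of_contDiffOn
        (contDiffOn_comp_right (hS.contDiffOn_christoffel_φ m j l)) hz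
    have hx : ∀ l, DifferentiableAt ℝ (fun w : Coords p n => w.2.2 l μ) z :=
      fun l => by fun_prop
    rw [der_neg]
    congr 1
    unfold nlN
    rw [der_sum S (xI p k) (F := fun l w => christoffel S.φ m j l w.2.1 * w.2.2 l μ) fun l _ => (hd l).mul (hx l)]
    simp only [der_mul S _ (hd _) (hx _), hder, der_coord, frame, nlN, sub_mul,
      Finset.sum_sub_distrib, mul_neg,
      ← sub_eq_add_neg]
    congr 1
    · exact Finset.sum_congr rfl fun l _ => by rw [hΓ m j l]
    · simp only [Finset.mul_sum, Finset.sum_mul]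
      rw [Finset.sum_comm]
      refine Finset.sum_congr rfl fun l _ => Finset.sum_congr rfl fun s _ => ?_
      rw [congrFun (hΓ m j s) _, congrFun (hΓ s k l) _]
      ring
  rw [hS.bracketCoeff_vI hz]
  simp only [frame, key, riem]
  simp only [Finset.sum_sub_distrib, sub_mul, add_mul, Finset.sum_add_distrib]
  ring

end RegularOn

end Space

/-! ### The connection coefficients as conformal changes. -/

namespace Space

variable {p n : ℕ} (S : Space p n) {U : Set (Eu p)} {V : Set (Eu n)} {z : Coords p n}

/-- `σ^i = φ^{im} σ_m`. -/
def σxUp (i : Fin n) (z : Coords p n) : ℝ := ∑ m, S.φUp z i m * S.σx m z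

variable {S}

theorem der_conformalTerm (A : Idx p n) {φ : Coords p n → Fin n → Fin n → ℝ}
    {s r : Fin n → Coords p n → ℝ} (hφ : ∀ i j, DifferentiableAt ℝ (fun w => φ w i j) z)
    (hs : ∀ i, DifferentiableAt ℝ (s i) z) (hr : ∀ i, DifferentiableAt ℝ (r i) z)
    (k i j : Fin n) :
    S.der A (fun w => conformalTerm (φ w) (fun a => s a w) (fun a => r a w) k i j) z
      = (if k = i then S.der A (s j) z else 0) + (if k = j then S.der A (s i) z else 0)
        - (S.der A (fun w => φ w i j) z * r k z + φ z i j * S.der A (r k) z) := by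
  have hite : ∀ (c : Prop) [Decidable c] {f : Coords p n → ℝ}, DifferentiableAt ℝ f z →
      DifferentiableAt ℝ (fun w => if c then f w else 0) z ∧
      S.der A (fun w => if c then f w else 0) z = if c then S.der A f z else 0 := by
    intro c _ f hf
    split_ifs
    · exact ⟨hf, rfl⟩
    · exact ⟨differentiableAt_const 0, der_const S A 0⟩
  have h1 := hite (k = i) (hs j)
  have h2 := hite (k = j) (hs i)
  simp only [conformalTerm]
  rw [der_sub S A (f := fun w => (if k = i then s j w else 0) + (if k = j then s i w else 0))
      (g := fun w => φ w i j * r k w) (h1.1.add h2.1) ((hφ i j).mul (hr k)),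
    der_add S A h1.1 h2.1, h1.2, h2.2,
    der_mul S A (hφ i j) (hr k)]

namespace RegularOn

variable (hS : S.RegularOn U V)
include hS

theorem φLow_comm (z : Coords p n) (i j : Fin n) : S.φLow z i j = S.φLow z j i :=
  (hS.isSymm_φ z.2.1).apply j i

theorem φUp_comm (z : Coords p n) (i j : Fin n) : S.φUp z i j = S.φUp z j i := by
  have : ((S.φ z.2.1)⁻¹).transpose = (S.φ z.2.1)⁻¹ := by
    rw [Matrix.transpose_nonsing_inv, (hS.isSymm_φ z.2.1).eq]
  exact congrFun (congrFun this j) i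

theorem sum_φUp_mul_φLow (hz : z ∈ jetsOver U V) (k j : Fin n) :
    ∑ m, S.φUp z k m * S.φLow z m j = if k = j then 1 else 0 := by
  have := congrFun (congrFun (Matrix.nonsing_inv_mul _ (hS.isUnit_det_φ _ hz.2)) k) j
  rwa [Matrix.mul_apply, Matrix.one_apply] at this

theorem sum_φLow_mul_φUp (hz : z ∈ jetsOver U V) (k j : Fin n) :
    ∑ m, S.φLow z k m * S.φUp z m j = if k = j then 1 else 0 := by
  have := congrFun (congrFun (Matrix.mul_nonsing_inv _ (hS.isUnit_det_φ _ hz.2)) k) j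
  rwa [Matrix.mul_apply, Matrix.one_apply] at this

theorem sum_φLow_mul_raise (hz : z ∈ jetsOver U V) (s : Fin n → ℝ) (i : Fin n) :
    ∑ m, S.φLow z i m * ∑ a, S.φUp z m a * s a = s i := by
  simp only [Finset.mul_sum, ← mul_assoc]
  rw [Finset.sum_comm]
  simp [← Finset.sum_mul, hS.sum_φLow_mul_φUp hz]

theorem sum_φUp_mul_lower (hz : z ∈ jetsOver U V) (r : Fin n → ℝ) (k : Fin n) :
    ∑ a, S.φUp z k a * ∑ m, S.φLow z a m * r m = r k := by
  simp only [Finset.mul_sum, ← mul_assoc]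
  rw [Finset.sum_comm]
  simp [← Finset.sum_mul, hS.sum_φUp_mul_φLow hz]

theorem sum_sum_φUp_mul_φLow (hz : z ∈ jetsOver U V) :
    ∑ i, ∑ j, S.φUp z i j * S.φLow z i j = n := by
  have h : ∀ i j, S.φUp z i j * S.φLow z i j = S.φUp z i j * S.φLow z j i :=
    fun i j => by rw [hS.φLow_comm z i j]
  rw [Finset.sum_congr rfl fun i _ => Finset.sum_congr rfl fun j _ => h i j]
  simp [hS.sum_φUp_mul_φLow hz]

theorem g_inv_apply (hz : z ∈ jetsOver U V) (k m : Fin n) :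
    (S.g z)⁻¹ k m = Real.exp (-2 * S.σ z) * S.φUp z k m := by
  have h : (S.g z)⁻¹ = Real.exp (-2 * S.σ z) • (S.φ z.2.1)⁻¹ := by
    apply Matrix.inv_eq_right_inv
    have : S.g z = Real.exp (2 * S.σ z) • S.φ z.2.1 := rfl
    rw [this, Matrix.smul_mul, Matrix.mul_smul, smul_smul,
      Matrix.mul_nonsing_inv _ (hS.isUnit_det_φ _ hz.2), ← Real.exp_add]
    simp
  rw [h]
  rfl

theorem der_g (hz : z ∈ jetsOver U V) (A : Idx p n) (i j : Fin n) :
    S.der A (fun w => S.g w i j) z = Real.exp (2 * S.σ z) *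
      (2 * S.der A S.σ z * S.φLow z i j + S.der A (fun w => S.φLow w i j) z) := by
  have hσ := hS.differentiableAt_σ hz
  have hφ := hS.differentiableAt_of_contDiffOn (hS.contDiffOn_φLow i j) hz
  change S.der A (fun w => Real.exp (2 * S.σ w) * S.φLow w i j) z = _
  rw [der_mul S A (hσ.const_mul 2).exp hφ, der_exp_two_mul S A hσ]
  ring

/-- The Christoffel symbols of a conformally changed metric, `P` being derivatives of `φ`. -/
theorem half_sum_g_inv_mul (hz : z ∈ jetsOver U V) (s : Fin n → ℝ)
    (P : Fin n → Fin n → Fin n → ℝ) (k i j : Fin n) :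
    (1 / 2) * ∑ m, (S.g z)⁻¹ k m *
        (Real.exp (2 * S.σ z) * (2 * s i * S.φLow z j m + P i j m)
          + Real.exp (2 * S.σ z) * (2 * s j * S.φLow z i m + P j i m)
          - Real.exp (2 * S.σ z) * (2 * s m * S.φLow z i j + P m i j))
      = (1 / 2) * ∑ m, S.φUp z k m * (P i j m + P j i m - P m i j)
        + conformalTerm (S.φLow z) s (fun a => ∑ m, S.φUp z a m * s m) k i j := by
  have hexp : Real.exp (-2 * S.σ z) * Real.exp (2 * S.σ z) = 1 := by
    rw [← Real.exp_add]
    simp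
  have hterm : ∀ m, (S.g z)⁻¹ k m *
        (Real.exp (2 * S.σ z) * (2 * s i * S.φLow z j m + P i j m)
          + Real.exp (2 * S.σ z) * (2 * s j * S.φLow z i m + P j i m)
          - Real.exp (2 * S.σ z) * (2 * s m * S.φLow z i j + P m i j))
      = S.φUp z k m * (P i j m + P j i m - P m i j)
        + (2 * s i * (S.φUp z k m * S.φLow z m j) + 2 * s j * (S.φUp z k m * S.φLow z m i)
          - 2 * S.φLow z i j * (S.φUp z k m * s m)) := by
    intro m
    rw [hS.g_inv_apply hz, hS.φLow_comm z m j, hS.φLow_comm z m i]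
    linear_combination (S.φUp z k m * (P i j m + P j i m - P m i j)
      + (2 * s i * (S.φUp z k m * S.φLow z j m) + 2 * s j * (S.φUp z k m * S.φLow z i m)
          - 2 * S.φLow z i j * (S.φUp z k m * s m))) * hexp
  simp only [hterm, Finset.sum_add_distrib, Finset.sum_sub_distrib, ← Finset.mul_sum,
    hS.sum_φUp_mul_φLow hz, conformalTerm]
  split_ifs <;> ring

theorem der_φLow_xI (hz : z ∈ jetsOver U V) (k i j : Fin n) :
    S.der (xI p k) (fun w => S.φLow w i j) z = pd (fun x => S.φ x i j) k z.2.1 :=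
  (hS.der_right hz (hS.contDiffOn_φ i j)).1 k

theorem der_φLow_vI (hz : z ∈ jetsOver U V) (k : Fin n) (γ : Fin p) (i j : Fin n) :
    S.der (vI k γ) (fun w => S.φLow w i j) z = 0 :=
  (hS.der_right hz (hS.contDiffOn_φ i j)).2 k γ

theorem cL_eq (hz : z ∈ jetsOver U V) (k i j : Fin n) :
    S.cL k i j z = christoffel S.φ k i j z.2.1
      + conformalTerm (S.φLow z) (fun a => S.σx a z) (fun a => S.σxUp a z) k i j := by
  simp only [cL, hS.der_g hz, hS.der_φLow_xI hz]
  exact hS.half_sum_g_inv_mul hz (fun a => S.σx a z)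
    (fun a b c => pd (fun x => S.φ x b c) a z.2.1) k i j

/-- φ is constant along the fibres, so no Christoffel part survives. -/
theorem cC_eq (hz : z ∈ jetsOver U V) (k i j : Fin n) (γ : Fin p) :
    S.cC k i j γ z
      = conformalTerm (S.φLow z) (fun a => S.σv a γ z) (fun a => S.σvUp a γ z) k i j := by
  -- The indices i and j are exchanged because C differentiates first along its last lower index.
  have h := hS.half_sum_g_inv_mul hz (fun a => S.σv a γ z) (fun _ _ _ => 0) k j i
  simp only [cC, hS.der_g hz, hS.der_φLow_vI hz]
  rw [hS.φLow_comm z i j]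
  refine h.trans ?_
  simp only [conformalTerm, hS.φLow_comm z j i, σvUp]
  simp [add_comm]

theorem contDiffOn_σx (i : Fin n) : ContDiffOn ℝ ∞ (S.σx i) (jetsOver U V) :=
  hS.contDiffOn_der _ hS.contDiffOn_σ

theorem contDiffOn_σv (i : Fin n) (α : Fin p) : ContDiffOn ℝ ∞ (S.σv i α) (jetsOver U V) :=
  hS.contDiffOn_der _ hS.contDiffOn_σ

theorem contDiffOn_raise {s : Fin n → Coords p n → ℝ}
    (hs : ∀ i, ContDiffOn ℝ ∞ (s i) (jetsOver U V)) (k : Fin n) :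
    ContDiffOn ℝ ∞ (fun w => ∑ m, S.φUp w k m * s m w) (jetsOver U V) :=
  ContDiffOn.sum fun m _ => (hS.contDiffOn_φUp k m).mul (hs m)

theorem contDiffOn_σxUp (k : Fin n) : ContDiffOn ℝ ∞ (S.σxUp k) (jetsOver U V) :=
  hS.contDiffOn_raise hS.contDiffOn_σx k

theorem contDiffOn_σvUp (k : Fin n) (γ : Fin p) :
    ContDiffOn ℝ ∞ (S.σvUp k γ) (jetsOver U V) :=
  hS.contDiffOn_raise (fun m => hS.contDiffOn_σv m γ) k

/-- The derivative of `s^k = φ^{km} s_m`. -/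
theorem der_raise (hz : z ∈ jetsOver U V) (A : Idx p n) {s : Fin n → Coords p n → ℝ}
    (hs : ∀ i, ContDiffOn ℝ ∞ (s i) (jetsOver U V)) (k : Fin n) :
    S.der A (fun w => ∑ m, S.φUp w k m * s m w) z
      = ∑ a, S.φUp z k a * (S.der A (s a) z
        - ∑ m, S.der A (fun w => S.φLow w a m) z * ∑ b, S.φUp z m b * s b z) := by
  have hr := fun m => hS.differentiableAt_of_contDiffOn (hS.contDiffOn_raise hs m) hz
  have hφ := fun i j => hS.differentiableAt_of_contDiffOn (hS.contDiffOn_φLow i j) hz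
  -- The relation s_a = φ_{am} s^m is differentiated instead of s^k = φ^{km} s_m, which avoids the
  -- derivative of the inverse matrix.
  have key : ∀ a, S.der A (s a) z
        - ∑ m, S.der A (fun w => S.φLow w a m) z * ∑ b, S.φUp z m b * s b z
      = ∑ m, S.φLow z a m * S.der A (fun w => ∑ b, S.φUp w m b * s b w) z := by
    intro a
    have h1 : S.der A (s a) z
        = S.der A (fun w => ∑ m, S.φLow w a m * ∑ b, S.φUp w m b * s b w) z :=
      hS.der_congr A (fun w hw => (hS.sum_φLow_mul_raise hw (fun b => s b w) a).symm) hz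
    rw [h1, der_sum S A (F := fun m w => S.φLow w a m * ∑ b, S.φUp w m b * s b w)
      fun m _ => (hφ a m).mul (hr m)]
    simp only [der_mul S A (hφ a _) (hr _), Finset.sum_add_distrib, add_sub_cancel_left]
  simp only [key, hS.sum_φUp_mul_lower hz]

/-- Lowering the upper index gives symbols of the first kind; in the sum of the two, everything but
the derivative of φ_{ij} along k cancels. -/
theorem φ_metric_compatible (hz : z ∈ jetsOver U V) (k i j : Fin n) :
    S.der (xI p k) (fun w => S.φLow w i j) z
      = ∑ m, (christoffel S.φ m k i z.2.1 * S.φLow z m j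
        + christoffel S.φ m k j z.2.1 * S.φLow z i m) := by
  have hlow : ∀ a b c, ∑ m, christoffel S.φ m a b z.2.1 * S.φLow z m c
      = (1 / 2) * (pd (fun x => S.φ x b c) a z.2.1 + pd (fun x => S.φ x a c) b z.2.1
        - pd (fun x => S.φ x a b) c z.2.1) := by
    intro a b c
    have := hS.sum_φLow_mul_raise hz (fun c => pd (fun x => S.φ x b c) a z.2.1
      + pd (fun x => S.φ x a c) b z.2.1 - pd (fun x => S.φ x a b) c z.2.1) c
    rw [← this, Finset.mul_sum]
    refine Finset.sum_congr rfl fun m _ => ?_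
    rw [hS.φLow_comm z m c]
    simp only [christoffel, φUp]
    ring
  have hsymm : ∀ a b c, pd (fun x => S.φ x a b) c z.2.1 = pd (fun x => S.φ x b a) c z.2.1 := by
    intro a b c
    congr 1
    exact funext fun x => (hS.isSymm_φ x).apply b a
  rw [hS.der_φLow_xI hz, Finset.sum_add_distrib, hlow]
  simp only [fun m => hS.φLow_comm z i m, hlow]
  rw [hsymm j i k, hsymm k i j, hsymm k j i]
  ring

end RegularOn

end Space

/-! ### The horizontal and vertical Ricci blocks. -/

namespace Space

variable {p n : ℕ} {S : Space p n} {U : Set (Eu p)} {V : Set (Eu n)} {z : Coords p n}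

namespace RegularOn

variable (hS : S.RegularOn U V) (hz : z ∈ jetsOver U V)
include hS hz

theorem der_cC (A : Idx p n) (k i j : Fin n) (γ : Fin p) :
    S.der A (S.cC k i j γ) z
      = (if k = i then S.der A (S.σv j γ) z else 0) + (if k = j then S.der A (S.σv i γ) z else 0)
        - (S.der A (fun w => S.φLow w i j) z * S.σvUp k γ z
          + S.φLow z i j * S.der A (S.σvUp k γ) z) := by
  rw [hS.der_congr A (fun w hw => hS.cC_eq hw k i j γ) hz]
  exact der_conformalTerm A (φ := S.φLow) (s := fun a => S.σv a γ) (r := fun a => S.σvUp a γ)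
    (fun i j => hS.differentiableAt_of_contDiffOn (hS.contDiffOn_φLow i j) hz)
    (fun i => hS.differentiableAt_of_contDiffOn (hS.contDiffOn_σv i γ) hz)
    (fun i => hS.differentiableAt_of_contDiffOn (hS.contDiffOn_σvUp i γ) hz) k i j

theorem der_cL (A : Idx p n) (k i j : Fin n) :
    S.der A (S.cL k i j) z = S.der A (fun w => christoffel S.φ k i j w.2.1) z
      + ((if k = i then S.der A (S.σx j) z else 0) + (if k = j then S.der A (S.σx i) z else 0)
        - (S.der A (fun w => S.φLow w i j) z * S.σxUp k z
          + S.φLow z i j * S.der A (S.σxUp k) z)) := by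
  have hφ := fun i j => hS.differentiableAt_of_contDiffOn (hS.contDiffOn_φLow i j) hz
  have hs := fun i => hS.differentiableAt_of_contDiffOn (hS.contDiffOn_σx i) hz
  have hr : ∀ i, DifferentiableAt ℝ (S.σxUp i) z := fun i => hS.differentiableAt_of_contDiffOn
    (hS.contDiffOn_σxUp i) hz
  have hΓ := hS.differentiableAt_of_contDiffOn
    (contDiffOn_comp_right (hS.contDiffOn_christoffel_φ k i j)) hz
  have hA : DifferentiableAt ℝ (fun w => conformalTerm (S.φLow w) (fun a => S.σx a w)
      (fun a => S.σxUp a w) k i j) z := by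
    simp only [conformalTerm]
    refine DifferentiableAt.sub (DifferentiableAt.add ?_ ?_) ((hφ i j).mul (hr k))
    · split_ifs
      exacts [hs j, differentiableAt_const 0]
    · split_ifs
      exacts [hs i, differentiableAt_const 0]
  rw [hS.der_congr A (fun w hw => hS.cL_eq hw k i j) hz, der_add S A hΓ hA,
    der_conformalTerm A hφ hs hr]

/-- The conformal part has trace nσ_i. At the level of derivatives, the subtracted terms recombine
into the derivative of φ_{im} σ^m = σ_i. -/
theorem sum_der_cL_contract (A : Idx p n) (i : Fin n) :
    ∑ k, S.der A (S.cL k i k) z = ∑ k, S.der A (fun w => christoffel S.φ k i k w.2.1) z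
      + n * S.der A (S.σx i) z := by
  have hr : ∀ i, DifferentiableAt ℝ (S.σxUp i) z := fun i => hS.differentiableAt_of_contDiffOn
    (hS.contDiffOn_σxUp i) hz
  have hφ := fun i j => hS.differentiableAt_of_contDiffOn (hS.contDiffOn_φLow i j) hz
  have key : S.der A (S.σx i) z = ∑ m, (S.der A (fun w => S.φLow w i m) z * S.σxUp m z
      + S.φLow z i m * S.der A (S.σxUp m) z) := by
    rw [hS.der_congr A (g := fun w => ∑ m, S.φLow w i m * S.σxUp m w)
      (fun w hw => (hS.sum_φLow_mul_raise hw (fun b => S.σx b w) i).symm) hz,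
      der_sum S A (F := fun m w => S.φLow w i m * S.σxUp m w) fun m _ => (hφ i m).mul (hr m)]
    simp only [der_mul S A (hφ i _) (hr _)]
  simp only [hS.der_cL hz, Finset.sum_add_distrib, Finset.sum_sub_distrib, if_true,
    Finset.sum_ite_eq', Finset.mem_univ, Finset.sum_const, Finset.card_univ, Fintype.card_fin,
    nsmul_eq_mul] at key ⊢
  linear_combination key

theorem sum_der_cC_contract (A : Idx p n) (i : Fin n) (γ : Fin p) :
    ∑ k, S.der A (S.cC k i k γ) z = n * S.der A (S.σv i γ) z := by
  have hr : ∀ i, DifferentiableAt ℝ (S.σvUp i γ) z := fun i => hS.differentiableAt_of_contDiffOn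
    (hS.contDiffOn_σvUp i γ) hz
  have hφ := fun i j => hS.differentiableAt_of_contDiffOn (hS.contDiffOn_φLow i j) hz
  have key : S.der A (S.σv i γ) z = ∑ m, (S.der A (fun w => S.φLow w i m) z * S.σvUp m γ z
      + S.φLow z i m * S.der A (S.σvUp m γ) z) := by
    rw [hS.der_congr A (g := fun w => ∑ m, S.φLow w i m * S.σvUp m γ w)
      (fun w hw => (hS.sum_φLow_mul_raise hw (fun b => S.σv b γ w) i).symm) hz,
      der_sum S A (F := fun m w => S.φLow w i m * S.σvUp m γ w) fun m _ => (hφ i m).mul (hr m)]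
    simp only [der_mul S A (hφ i _) (hr _)]
  simp only [hS.der_cC hz, Finset.sum_add_distrib, Finset.sum_sub_distrib, if_true,
    Finset.sum_ite_eq', Finset.mem_univ, Finset.sum_const, Finset.card_univ, Fintype.card_fin,
    nsmul_eq_mul] at key ⊢
  linear_combination key

theorem der_vI_σv_comm (i j : Fin n) (α β : Fin p) :
    S.der (vI i α) (S.σv j β) z = S.der (vI j β) (S.σv i α) z := by
  have := hS.der_der_sub_der_der hz (vI i α) (vI j β) hS.contDiffOn_σ
  simp only [hS.bracketCoeff_vI_vI hz, zero_mul, Finset.sum_const_zero] at this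
  exact sub_eq_zero.1 this

/-- The vertical part of the Ricci d-tensor. -/
theorem Ric_vI_vI (i j : Fin n) (α β : Fin p) : S.Ric (vI i α) (vI j β) z
    = (2 - (n : ℝ)) * S.der (vI j β) (S.σv i α) z
      - (S.der (vI j β) (S.σv i α) z - S.der (vI j α) (S.σv i β) z)
      - S.φLow z i j * ∑ r, ∑ s, S.φUp z r s * S.der (vI s β) (S.σv r α) z
      + ((n : ℝ) - 2) * (S.σv i β z * S.σv j α z
        - S.φLow z i j * ∑ r, ∑ m, S.φUp z r m * S.σv r α z * S.σv m β z) := by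
  have hq := sum_conformalTerm_quadratic (hS.φLow_comm z)
    (hS.sum_φLow_mul_raise hz fun a => S.σv a β z) (hS.sum_φLow_mul_raise hz fun a => S.σv a α z)
    i j
  have hr : ∀ k, S.der (vI k α) (S.σvUp k β) z
      = ∑ s, S.φUp z k s * S.der (vI s β) (S.σv k α) z := by
    intro k
    refine (hS.der_raise hz _ (s := fun a => S.σv a β) (fun a => hS.contDiffOn_σv a β) k).trans ?_
    simp only [hS.der_φLow_vI hz, zero_mul, Finset.sum_const_zero, sub_zero,
      hS.der_vI_σv_comm hz k]
  have hN : ∑ k, (∑ m, S.φUp z k m * S.σv m β z) * S.σv k α z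
      = ∑ r, ∑ m, S.φUp z r m * S.σv r α z * S.σv m β z := by
    refine Finset.sum_congr rfl fun k _ => ?_
    rw [Finset.sum_mul]
    exact Finset.sum_congr rfl fun m _ => by ring
  rw [hN] at hq
  rw [hS.Ric_vI_vI_eq_sum hz]
  simp only [Finset.sum_add_distrib (f := fun k => _ - _), Finset.sum_sub_distrib (f := fun k =>
    S.der _ _ _), hS.sum_der_cC_contract hz, hS.cC_eq hz]
  rw [show (fun a => S.σvUp a β z) = fun a => ∑ m, S.φUp z a m * S.σv m β z from rfl,
    show (fun a => S.σvUp a α z) = fun a => ∑ m, S.φUp z a m * S.σv m α z from rfl, hq]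
  simp only [hS.der_cC hz, hS.der_φLow_vI hz, hr, zero_mul, zero_add, Finset.sum_add_distrib,
    Finset.sum_sub_distrib, Finset.sum_ite_eq', Finset.mem_univ, if_true, ← Finset.mul_sum,
    hS.der_vI_σv_comm hz i j α β]
  ring

/-- The contraction `φ^{ij} S^{(α)(β)}_{(i)(j)} = -2 (n - 1) φ^{rs} σ^{(α)(β)}_{(r)(s)}`. -/
theorem sum_φUp_mul_Ric_vI_vI (α β : Fin p) :
    ∑ i, ∑ j, S.φUp z i j * S.Ric (vI i α) (vI j β) z
      = - 2 * ((n : ℝ) - 1) * ∑ r, ∑ s, S.φUp z r s * S.σvv r α s β z := by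
  -- Contraction with the symmetric φ^{ij} makes the exchange of α and β immaterial, so the skew
  -- term of `Ric_vI_vI` disappears.
  have hD : ∑ i, ∑ j, S.φUp z i j * S.der (vI j α) (S.σv i β) z
      = ∑ r, ∑ s, S.φUp z r s * S.der (vI s β) (S.σv r α) z := by
    rw [Finset.sum_comm]
    refine Finset.sum_congr rfl fun i _ => Finset.sum_congr rfl fun j _ => ?_
    rw [hS.φUp_comm z j i, hS.der_vI_σv_comm hz i j]
  have hN : ∑ i, ∑ j, S.φUp z i j * (S.σv i β z * S.σv j α z)
      = ∑ r, ∑ m, S.φUp z r m * S.σv r α z * S.σv m β z := by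
    rw [Finset.sum_comm]
    refine Finset.sum_congr rfl fun i _ => Finset.sum_congr rfl fun j _ => ?_
    rw [hS.φUp_comm z j i]
    ring
  have hN' : ∑ i, ∑ j, S.φUp z i j * (S.σv i α z * S.σv j β z)
      = ∑ r, ∑ m, S.φUp z r m * S.σv r α z * S.σv m β z := by
    simp only [mul_assoc]
  have hφ := hS.sum_sum_φUp_mul_φLow hz
  set D := ∑ r, ∑ s, S.φUp z r s * S.der (vI s β) (S.σv r α) z with hDdef
  set N := ∑ r, ∑ m, S.φUp z r m * S.σv r α z * S.σv m β z with hNdef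
  have h1 : ∀ i j, S.φUp z i j * S.Ric (vI i α) (vI j β) z
      = (1 - (n : ℝ)) * (S.φUp z i j * S.der (vI j β) (S.σv i α) z)
        + S.φUp z i j * S.der (vI j α) (S.σv i β) z
        + ((n : ℝ) - 2) * (S.φUp z i j * (S.σv i β z * S.σv j α z))
        - (D + ((n : ℝ) - 2) * N) * (S.φUp z i j * S.φLow z i j) := by
    intro i j
    rw [hS.Ric_vI_vI hz]
    ring
  have h2 : ∀ r s, S.φUp z r s * S.σvv r α s β z
      = S.φUp z r s * S.der (vI s β) (S.σv r α) z - S.φUp z r s * (S.σv r α z * S.σv s β z)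
        + (1 / 2) * N * (S.φUp z r s * S.φLow z r s) := by
    intro r s
    rw [σvv]
    ring
  simp only [h1, h2, Finset.sum_add_distrib, Finset.sum_sub_distrib, ← Finset.mul_sum, hD, hN,
    hN', hφ, ← hDdef]
  ring

/-- Since φ is parallel, the divergence of the raised covector is the trace of its covariant
derivative. -/
theorem der_raise_σx_sum :
    ∑ k, S.der (xI p k) (S.σxUp k) z
        + ∑ k, ∑ m, christoffel S.φ k k m z.2.1 * S.σxUp m z
      = ∑ r, ∑ s, S.φUp z r s * (S.der (xI p s) (S.σx r) z
        - ∑ m, christoffel S.φ m r s z.2.1 * S.σx m z) := by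
  have hΓ := fun a b c => congrFun (christoffel_comm hS.isSymm_φ a b c) z.2.1
  have hlow := hS.sum_φLow_mul_raise hz fun b => S.σx b z
  have hd : ∀ k, S.der (xI p k) (S.σxUp k) z
      = ∑ a, S.φUp z k a * (S.der (xI p k) (S.σx a) z
          - ∑ m, christoffel S.φ m a k z.2.1 * S.σx m z)
        - ∑ m, christoffel S.φ k k m z.2.1 * S.σxUp m z := by
    intro k
    refine (hS.der_raise hz _ hS.contDiffOn_σx k).trans ?_
    have h1 : ∀ a, ∑ m, S.der (xI p k) (fun w => S.φLow w a m) z * S.σxUp m z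
        = ∑ l, christoffel S.φ l a k z.2.1 * S.σx l z
          + ∑ l, S.φLow z a l * ∑ m, christoffel S.φ l k m z.2.1 * S.σxUp m z := by
      intro a
      simp only [hS.φ_metric_compatible hz, Finset.sum_mul, add_mul, Finset.sum_add_distrib]
      congr 1
      · rw [Finset.sum_comm]
        refine Finset.sum_congr rfl fun l _ => ?_
        rw [← hlow l, Finset.mul_sum]
        refine Finset.sum_congr rfl fun m _ => ?_
        rw [hΓ l k a]
        simp only [σxUp]
        ring
      · rw [Finset.sum_comm]
        refine Finset.sum_congr rfl fun l _ => ?_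
        rw [Finset.mul_sum]
        exact Finset.sum_congr rfl fun m _ => by ring
    have h2 := hS.sum_φUp_mul_lower hz
      (fun l => ∑ m, christoffel S.φ l k m z.2.1 * S.σxUp m z) k
    rw [← h2, ← Finset.sum_sub_distrib]
    refine Finset.sum_congr rfl fun a _ => ?_
    have h1a := h1 a
    simp only [σxUp] at h1a ⊢
    rw [h1a]
    ring
  simp only [hd, Finset.sum_sub_distrib, sub_add_cancel]
  rw [Finset.sum_comm]
  refine Finset.sum_congr rfl fun r _ => Finset.sum_congr rfl fun s _ => ?_
  rw [hS.φUp_comm z s r]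

/-- The contribution of the nonholonomy of the adapted basis to the horizontal Ricci tensor. -/
theorem sum_cC_mul_bracketCoeff (i j : Fin n) :
    ∑ k, ∑ m, ∑ μ, S.cC k i m μ z * S.bracketCoeff (vI m μ) (xI p k) (xI p j) z
      = S.der (xI p i) (S.σx j) z - S.der (xI p j) (S.σx i) z
        + ∑ m, ∑ q, ((∑ s, S.φLow z i s * riem S.φ s m j q z.2.1)
          - ricci S.φ m j z.2.1 * S.φLow z i q) * ∑ μ, S.σvUp q μ z * z.2.2 m μ := by
  -- The first Kronecker delta of C feeds σ to the bracket of δ/δx^i and δ/δx^j, which is their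
  -- commutator on σ.
  have h0 : S.der (xI p i) (S.σx j) z - S.der (xI p j) (S.σx i) z
      = ∑ μ, ∑ m, S.σv m μ z * S.bracketCoeff (vI m μ) (xI p i) (xI p j) z := by
    rw [Finset.sum_comm]
    refine (hS.der_der_sub_der_der hz (xI p i) (xI p j) hS.contDiffOn_σ).trans ?_
    exact Finset.sum_congr rfl fun m _ => Finset.sum_congr rfl fun μ _ => mul_comm _ _
  have h1 : ∀ μ, ∑ k, ∑ m, S.cC k i m μ z * S.bracketCoeff (vI m μ) (xI p k) (xI p j) z
      = ∑ m, S.σv m μ z * S.bracketCoeff (vI m μ) (xI p i) (xI p j) z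
        + ∑ m, ∑ q, ((∑ s, S.φLow z i s * riem S.φ s m j q z.2.1)
          - ricci S.φ m j z.2.1 * S.φLow z i q) * (S.σvUp q μ z * z.2.2 m μ) := by
    intro μ
    have hterm : ∀ k m, S.cC k i m μ z * S.bracketCoeff (vI m μ) (xI p k) (xI p j) z
        = (if k = i then S.σv m μ z * S.bracketCoeff (vI m μ) (xI p k) (xI p j) z else 0)
          + (if k = m then S.σv i μ z * S.bracketCoeff (vI m μ) (xI p k) (xI p j) z else 0)
          + ∑ l, S.φLow z i m * riem S.φ m l j k z.2.1 * (S.σvUp k μ z * z.2.2 l μ) := by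
      intro k m
      have : ∑ l, S.φLow z i m * riem S.φ m l j k z.2.1 * (S.σvUp k μ z * z.2.2 l μ)
          = - (S.φLow z i m * S.σvUp k μ z * S.bracketCoeff (vI m μ) (xI p k) (xI p j) z) := by
        rw [hS.bracketCoeff_vI_xI_xI hz, mul_neg, neg_neg, Finset.mul_sum]
        exact Finset.sum_congr rfl fun l _ => by ring
      rw [this, hS.cC_eq hz, conformalTerm]
      split_ifs <;> ring
    -- The second delta takes the trace of the bracket coefficients, which is minus the Ricci tensor
    -- of φ contracted with the fibre coordinates.
    have hric : ∑ k, S.σv i μ z * S.bracketCoeff (vI k μ) (xI p k) (xI p j) z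
        = - ∑ m, ∑ q, ricci S.φ m j z.2.1 * S.φLow z i q * (S.σvUp q μ z * z.2.2 m μ) := by
      simp only [hS.bracketCoeff_vI_xI_xI hz, mul_neg, Finset.sum_neg_distrib, ← Finset.mul_sum]
      rw [Finset.sum_comm, Finset.mul_sum]
      congr 1
      refine Finset.sum_congr rfl fun m _ => ?_
      rw [← hS.sum_φLow_mul_raise hz (fun b => S.σv b μ z) i, ← Finset.sum_mul]
      rw [Finset.sum_mul]
      simp only [ricci, σvUp]
      exact Finset.sum_congr rfl fun q _ => by ring
    simp only [hterm, Finset.sum_add_distrib]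
    have e1 : ∑ k, ∑ m, (if k = i then
        S.σv m μ z * S.bracketCoeff (vI m μ) (xI p k) (xI p j) z else 0)
        = ∑ m, S.σv m μ z * S.bracketCoeff (vI m μ) (xI p i) (xI p j) z := by
      rw [Finset.sum_comm]
      simp
    have e2 : ∑ k, ∑ m, (if k = m then
        S.σv i μ z * S.bracketCoeff (vI m μ) (xI p k) (xI p j) z else 0)
        = ∑ k, S.σv i μ z * S.bracketCoeff (vI k μ) (xI p k) (xI p j) z := by
      simp
    have e3 : ∑ k, ∑ m, ∑ l,
        S.φLow z i m * riem S.φ m l j k z.2.1 * (S.σvUp k μ z * z.2.2 l μ)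
        = ∑ m, ∑ q, (∑ s, S.φLow z i s * riem S.φ s m j q z.2.1)
          * (S.σvUp q μ z * z.2.2 m μ) := by
      simp only [Finset.sum_mul]
      rw [Finset.sum_congr rfl fun k _ => Finset.sum_comm, Finset.sum_comm]
    rw [e1, e2, e3, hric]
    simp only [sub_mul, Finset.sum_sub_distrib]
    ring
  rw [h0]
  calc _ = ∑ μ, ∑ k, ∑ m, S.cC k i m μ z * S.bracketCoeff (vI m μ) (xI p k) (xI p j) z := by
        symm
        rw [Finset.sum_comm]
        exact Finset.sum_congr rfl fun k _ => Finset.sum_comm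
    _ = _ := by
        simp only [h1, Finset.sum_add_distrib]
        congr 1
        rw [Finset.sum_comm]
        refine Finset.sum_congr rfl fun m _ => ?_
        rw [Finset.sum_comm]
        exact Finset.sum_congr rfl fun q _ => by rw [Finset.mul_sum]

/-- The horizontal part of the Ricci d-tensor. -/
theorem Ric_xI_xI (i j : Fin n) : S.Ric (xI p i) (xI p j) z
    = ricci S.φ i j z.2.1 + (2 - (n : ℝ)) * S.σxx i j z - S.φLow z i j * S.trσ z
      - ∑ m, ∑ q, ((∑ s, S.φLow z i s * riem S.φ s m j q z.2.1)
          - ricci S.φ m j z.2.1 * S.φLow z i q) * ∑ μ, S.σvUp q μ z * z.2.2 m μ := by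
  have hΓ := fun a b c => congrFun (christoffel_comm hS.isSymm_φ a b c) z.2.1
  have hs := hS.sum_φLow_mul_raise hz fun a => S.σx a z
  have hquad := sum_conformalTerm_quadratic (hS.φLow_comm z) hs hs i j
  have hlin := sum_conformalTerm_linear hΓ hs
    (fun k a => S.der (xI p k) (S.σx a) z) (fun k => S.der (xI p k) (S.σxUp k) z) i j
  have hvert := hS.sum_cC_mul_bracketCoeff hz i j
  have hcontr := hS.sum_der_cL_contract hz (xI p j) i
  have hΔ := hS.der_raise_σx_sum hz
  have hder := fun a b c d => (hS.der_right hz (hS.contDiffOn_christoffel_φ a b c)).1 d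
  -- With L = γ + A, the terms in γ alone give the Ricci tensor of φ. The rest is sorted into the
  -- parts linear and quadratic in A, the traced derivative, and the nonholonomy term.
  have hR : S.Ric (xI p i) (xI p j) z
      = ricci S.φ i j z.2.1
        + (∑ k, (S.der (xI p k) (S.cL k i j) z - pd (christoffel S.φ k i j) k z.2.1)
          + ∑ k, ∑ m, (conformalTerm (S.φLow z) (fun a => S.σx a z)
                (fun a => ∑ m, S.φUp z a m * S.σx m z) m i j * christoffel S.φ k m k z.2.1
              + christoffel S.φ m i j z.2.1 * conformalTerm (S.φLow z) (fun a => S.σx a z)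
                (fun a => ∑ m, S.φUp z a m * S.σx m z) k m k
              - conformalTerm (S.φLow z) (fun a => S.σx a z)
                (fun a => ∑ m, S.φUp z a m * S.σx m z) m i k * christoffel S.φ k m j z.2.1
              - christoffel S.φ m i k z.2.1 * conformalTerm (S.φLow z) (fun a => S.σx a z)
                (fun a => ∑ m, S.φUp z a m * S.σx m z) k m j))
        + ((n : ℝ) - 2) * (S.σx i z * S.σx j z
          - S.φLow z i j * ∑ k, (∑ m, S.φUp z k m * S.σx m z) * S.σx k z)
        - (∑ k, S.der (xI p j) (S.cL k i k) z
          - ∑ k, pd (christoffel S.φ k i k) j z.2.1)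
        - ∑ k, ∑ m, ∑ μ, S.cC k i m μ z * S.bracketCoeff (vI m μ) (xI p k) (xI p j) z := by
    rw [hS.Ric_xI_xI_eq_sum hz, ← hquad]
    simp only [ricci, riem, ← Finset.sum_add_distrib, ← Finset.sum_sub_distrib]
    refine Finset.sum_congr rfl fun k _ => ?_
    have hprod : ∀ m, S.cL m i j z * S.cL k m k z - S.cL m i k z * S.cL k m j z
        = (christoffel S.φ m i j z.2.1 + conformalTerm (S.φLow z) (fun a => S.σx a z)
            (fun a => ∑ m, S.φUp z a m * S.σx m z) m i j)
          * (christoffel S.φ k m k z.2.1 + conformalTerm (S.φLow z) (fun a => S.σx a z)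
            (fun a => ∑ m, S.φUp z a m * S.σx m z) k m k)
          - (christoffel S.φ m i k z.2.1 + conformalTerm (S.φLow z) (fun a => S.σx a z)
            (fun a => ∑ m, S.φUp z a m * S.σx m z) m i k)
          * (christoffel S.φ k m j z.2.1 + conformalTerm (S.φLow z) (fun a => S.σx a z)
            (fun a => ∑ m, S.φUp z a m * S.σx m z) k m j) := by
      intro m
      simp only [hS.cL_eq hz]
      rfl
    simp only [hprod, mul_add, add_mul, Finset.sum_add_distrib, Finset.sum_sub_distrib]
    ring
  have hA : ∑ k, (S.der (xI p k) (S.cL k i j) z - pd (christoffel S.φ k i j) k z.2.1)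
      = ∑ k, ((if k = i then S.der (xI p k) (S.σx j) z else 0)
          + (if k = j then S.der (xI p k) (S.σx i) z else 0)
        - ((∑ m, (christoffel S.φ m k i z.2.1 * S.φLow z m j
            + christoffel S.φ m k j z.2.1 * S.φLow z i m)) * ∑ m, S.φUp z k m * S.σx m z
          + S.φLow z i j * S.der (xI p k) (S.σxUp k) z)) := by
    refine Finset.sum_congr rfl fun k _ => ?_
    rw [hS.der_cL hz, hder, hS.φ_metric_compatible hz, add_sub_cancel_left]
    rfl
  have hN : ∑ k, (∑ m, S.φUp z k m * S.σx m z) * S.σx k z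
      = ∑ r, ∑ m, S.φUp z r m * S.σx r z * S.σx m z := by
    refine Finset.sum_congr rfl fun k _ => ?_
    rw [Finset.sum_mul]
    exact Finset.sum_congr rfl fun m _ => by ring
  have hφ := hS.sum_sum_φUp_mul_φLow hz
  have htr : S.trσ z = ∑ r, ∑ s, S.φUp z r s * (S.der (xI p s) (S.σx r) z
        - ∑ m, christoffel S.φ m r s z.2.1 * S.σx m z)
      + ((n : ℝ) / 2 - 1) * ∑ r, ∑ m, S.φUp z r m * S.σx r z * S.σx m z := by
    have hterm : ∀ r s, S.φUp z r s * S.σxx r s z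
        = S.φUp z r s * (S.der (xI p s) (S.σx r) z
            - ∑ m, christoffel S.φ m r s z.2.1 * S.σx m z)
          - S.φUp z r s * S.σx r z * S.σx s z
          + (1 / 2) * (∑ r, ∑ m, S.φUp z r m * S.σx r z * S.σx m z)
            * (S.φUp z r s * S.φLow z r s) := by
      intro r s
      rw [σxx]
      ring
    simp only [trσ, hterm, Finset.sum_add_distrib, Finset.sum_sub_distrib (f := fun s =>
      S.φUp z _ s * (_ - _)), Finset.sum_sub_distrib (f := fun r => ∑ s, S.φUp z r s * (_ - _)),
      ← Finset.mul_sum, hφ]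
    ring
  simp only [hder] at hcontr
  -- The derivative of σ_j along i is cancelled by the nonholonomy term. What remains is 2 - n times
  -- that of σ_i along j, the index order of σ_{ij}, so no symmetry of σ_{ij} is needed.
  rw [hR, hA, hlin, hcontr, hvert, hN, htr, σxx]
  simp only [σxUp] at hΔ ⊢
  rw [← hΔ]
  ring

end RegularOn

end Space

/-! ### Scalar curvatures and the Einstein equations. -/

theorem riem_antisymm {d : ℕ} (g : Eu d → Matrix (Fin d) (Fin d) ℝ) (l i j k : Fin d) (x : Eu d) :
    riem g l i j k x = - riem g l i k j x := by
  simp only [riem, Finset.sum_sub_distrib]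
  ring

namespace Space

variable {p n : ℕ}

section Potential

variable (S : Space p n) (z : Coords p n)

theorem GLow_tI_tI (α β : Fin p) : S.GLow (tI n α) (tI n β) z = S.hLow z α β := by
  simp only [GLow, G, coframe_frame]
  simp

theorem GLow_xI_xI (i j : Fin n) :
    S.GLow (xI p i) (xI p j) z = Real.exp (2 * S.σ z) * S.φLow z i j := by
  simp only [GLow, G, coframe_frame]
  simp

theorem GLow_vI_vI (i : Fin n) (α : Fin p) (j : Fin n) (β : Fin p) :
    S.GLow (vI i α) (vI j β) z = S.hUp z α β * Real.exp (2 * S.σ z) * S.φLow z i j := by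
  simp only [GLow, G, coframe_frame]
  simp [ite_and]

theorem GLow_tI_xI (α : Fin p) (i : Fin n) : S.GLow (tI n α) (xI p i) z = 0 := by
  simp only [GLow, G, coframe_frame]
  simp

theorem GLow_xI_tI (i : Fin n) (α : Fin p) : S.GLow (xI p i) (tI n α) z = 0 := by
  simp only [GLow, G, coframe_frame]
  simp

theorem GLow_tI_vI (α : Fin p) (i : Fin n) (β : Fin p) :
    S.GLow (tI n α) (vI i β) z = 0 := by
  simp only [GLow, G, coframe_frame]
  simp

theorem GLow_vI_tI (i : Fin n) (β α : Fin p) : S.GLow (vI i β) (tI n α) z = 0 := by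
  simp only [GLow, G, coframe_frame]
  simp

theorem GLow_xI_vI (i j : Fin n) (β : Fin p) : S.GLow (xI p i) (vI j β) z = 0 := by
  simp only [GLow, G, coframe_frame]
  simp

theorem GLow_vI_xI (i : Fin n) (β : Fin p) (j : Fin n) : S.GLow (vI i β) (xI p j) z = 0 := by
  simp only [GLow, G, coframe_frame]
  simp

end Potential

namespace RegularOn

variable {S : Space p n} {U : Set (Eu p)} {V : Set (Eu n)} {z : Coords p n}
  (hS : S.RegularOn U V) (hz : z ∈ jetsOver U V)
include hS hz

/-- `Sc(CΓ) = H + R + S`. -/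
theorem Sc_eq : S.Sc z = S.sH z + S.sR z + S.sS z := by
  have hT : ∑ α, ∑ β, S.hUp z α β * S.Ric (tI n α) (tI n β) z = S.sH z := by
    simp only [hS.Ric_tI_tI hz]
    rfl
  have hX : ∑ i, ∑ j, Real.exp (-2 * S.σ z) * S.φUp z i j * S.Ric (xI p i) (xI p j) z
      = S.sR z := by
    simp only [sR, Finset.mul_sum, mul_assoc]
  have hV : ∑ i, ∑ α, ∑ j, ∑ β, S.hLow z α β * Real.exp (-2 * S.σ z) * S.φUp z i j
      * S.Ric (vI i α) (vI j β) z = S.sS z := by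
    simp only [sS, Finset.mul_sum, mul_assoc]
    rw [Finset.sum_comm]
    refine Finset.sum_congr rfl fun α _ => ?_
    rw [Finset.sum_congr rfl fun i _ => Finset.sum_comm, Finset.sum_comm]
  rw [← hT, ← hX, ← hV]
  simp only [Sc, Fintype.sum_sum_type, Fintype.sum_prod_type, GUp]
  simp only [zero_mul, Finset.sum_const_zero, add_zero, zero_add, ← add_assoc]

theorem exp_mul_sR : S.sR z * Real.exp (2 * S.σ z)
    = scalar S.φ z.2.1 + (2 - 2 * (n : ℝ)) * S.trσ z
      + 2 * ∑ m, ∑ q, ricci S.φ m q z.2.1 * ∑ μ, S.σvUp q μ z * z.2.2 m μ := by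
  have hexp : Real.exp (-2 * S.σ z) * Real.exp (2 * S.σ z) = 1 := by
    rw [← Real.exp_add]
    simp
  -- Each of the two terms contributes -r_{mq}; the first is r^j_{mjq}, the Ricci contraction on the
  -- other skew index.
  have hW : ∀ m q, ∑ i, ∑ j, S.φUp z i j * ((∑ s, S.φLow z i s * riem S.φ s m j q z.2.1)
      - ricci S.φ m j z.2.1 * S.φLow z i q) = - 2 * ricci S.φ m q z.2.1 := by
    intro m q
    have h1 : ∑ i, ∑ j, S.φUp z i j * ∑ s, S.φLow z i s * riem S.φ s m j q z.2.1
        = - ricci S.φ m q z.2.1 := by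
      rw [Finset.sum_comm]
      simp only [fun j i => hS.φUp_comm z i j]
      have := fun j => hS.sum_φUp_mul_lower hz (fun s => riem S.φ s m j q z.2.1) j
      simp only [this, ricci, ← Finset.sum_neg_distrib]
      exact Finset.sum_congr rfl fun j _ => riem_antisymm _ _ _ _ _ _
    have h2 : ∑ i, ∑ j, S.φUp z i j * (ricci S.φ m j z.2.1 * S.φLow z i q)
        = ricci S.φ m q z.2.1 := by
      rw [← hS.sum_φLow_mul_raise hz (fun j => ricci S.φ m j z.2.1) q]
      refine Finset.sum_congr rfl fun i _ => ?_
      rw [Finset.mul_sum, hS.φLow_comm z q i]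
      exact Finset.sum_congr rfl fun j _ => by ring
    simp only [mul_sub, Finset.sum_sub_distrib, h1, h2]
    ring
  have hterm : ∀ i j, S.φUp z i j * S.Ric (xI p i) (xI p j) z
      = S.φUp z i j * ricci S.φ i j z.2.1 + (2 - (n : ℝ)) * (S.φUp z i j * S.σxx i j z)
        - S.trσ z * (S.φUp z i j * S.φLow z i j)
        - ∑ m, ∑ q, S.φUp z i j * ((∑ s, S.φLow z i s * riem S.φ s m j q z.2.1)
          - ricci S.φ m j z.2.1 * S.φLow z i q) * ∑ μ, S.σvUp q μ z * z.2.2 m μ := by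
    intro i j
    rw [hS.Ric_xI_xI hz]
    simp only [mul_assoc, ← Finset.mul_sum]
    ring
  have hsum : ∑ i, ∑ j, ∑ m, ∑ q, S.φUp z i j
        * ((∑ s, S.φLow z i s * riem S.φ s m j q z.2.1)
          - ricci S.φ m j z.2.1 * S.φLow z i q) * ∑ μ, S.σvUp q μ z * z.2.2 m μ
      = - 2 * ∑ m, ∑ q, ricci S.φ m q z.2.1 * ∑ μ, S.σvUp q μ z * z.2.2 m μ := by
    have hswap : ∀ F : Fin n → Fin n → Fin n → Fin n → ℝ,
        ∑ i, ∑ j, ∑ m, ∑ q, F i j m q = ∑ m, ∑ q, ∑ i, ∑ j, F i j m q := by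
      intro F
      rw [Finset.sum_congr rfl fun i _ => Finset.sum_comm, Finset.sum_comm]
      refine Finset.sum_congr rfl fun m _ => ?_
      rw [Finset.sum_congr rfl fun i _ => Finset.sum_comm, Finset.sum_comm]
    rw [hswap]
    simp only [← Finset.sum_mul, hW]
    simp only [Finset.mul_sum, mul_assoc]
  have htotal : ∑ i, ∑ j, S.φUp z i j * S.Ric (xI p i) (xI p j) z
      = scalar S.φ z.2.1 + (2 - 2 * (n : ℝ)) * S.trσ z
      + 2 * ∑ m, ∑ q, ricci S.φ m q z.2.1 * ∑ μ, S.σvUp q μ z * z.2.2 m μ := by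
    have h1 : ∑ i, ∑ j, S.φUp z i j * ricci S.φ i j z.2.1 = scalar S.φ z.2.1 := rfl
    have h2 : ∑ i, ∑ j, S.φUp z i j * S.σxx i j z = S.trσ z := rfl
    simp only [hterm, Finset.sum_add_distrib, Finset.sum_sub_distrib (f := fun j => _ + _ - _),
      Finset.sum_sub_distrib (f := fun j => _ + _), hsum, ← Finset.mul_sum, h1, h2,
      hS.sum_sum_φUp_mul_φLow hz]
    ring
  rw [sR, htotal]
  linear_combination (scalar S.φ z.2.1 + (2 - 2 * (n : ℝ)) * S.trσ z
      + 2 * ∑ m, ∑ q, ricci S.φ m q z.2.1 * ∑ μ, S.σvUp q μ z * z.2.2 m μ) * hexp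

/-- This is where ρ comes from: subtracting half the trace changes the coefficient of <σ>φ_{ij} from
-1 to n - 2 and supplies the term r_{mq} φ_{ij} in its bracket. -/
theorem Ric_xI_xI_sub_half_sR (i j : Fin n) :
    S.Ric (xI p i) (xI p j) z - S.sR z / 2 * (Real.exp (2 * S.σ z) * S.φLow z i j)
      = ricci S.φ i j z.2.1 - scalar S.φ z.2.1 / 2 * S.φLow z i j + S.ρ i j z := by
  have h := hS.exp_mul_sR hz
  have hρ : ∑ m, ∑ q, ((∑ s, S.φLow z i s * riem S.φ s m j q z.2.1)
        + ricci S.φ m q z.2.1 * S.φLow z i j - ricci S.φ m j z.2.1 * S.φLow z i q)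
      * ∑ μ, S.σvUp q μ z * z.2.2 m μ
      = (∑ m, ∑ q, ((∑ s, S.φLow z i s * riem S.φ s m j q z.2.1)
          - ricci S.φ m j z.2.1 * S.φLow z i q) * ∑ μ, S.σvUp q μ z * z.2.2 m μ)
        + S.φLow z i j * ∑ m, ∑ q, ricci S.φ m q z.2.1 * ∑ μ, S.σvUp q μ z * z.2.2 m μ := by
    rw [Finset.mul_sum, ← Finset.sum_add_distrib]
    refine Finset.sum_congr rfl fun m _ => ?_
    rw [Finset.mul_sum, ← Finset.sum_add_distrib]
    exact Finset.sum_congr rfl fun q _ => by ring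
  rw [hS.Ric_xI_xI hz, ρ, hρ]
  linear_combination (- S.φLow z i j / 2) * h

theorem exp_mul_sS : S.sS z * Real.exp (2 * S.σ z) = - 2 * ((n : ℝ) - 1) * S.trtrσ z := by
  have hexp : Real.exp (-2 * S.σ z) * Real.exp (2 * S.σ z) = 1 := by
    rw [← Real.exp_add]
    simp
  have h : S.sS z = Real.exp (-2 * S.σ z) * (- 2 * ((n : ℝ) - 1) * S.trtrσ z) := by
    simp only [sS, trtrσ, hS.sum_φUp_mul_Ric_vI_vI hz, Finset.mul_sum (s := (Finset.univ :
      Finset (Fin p)))]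
    exact Finset.sum_congr rfl fun α _ => Finset.sum_congr rfl fun β _ => by ring
  rw [h]
  linear_combination (- 2 * ((n : ℝ) - 1) * S.trtrσ z) * hexp

theorem einsteinEquations_iff {K : ℝ} (hK : K ≠ 0) (𝒯 : Idx p n → Idx p n → ℝ) :
    S.EinsteinEquations K 𝒯 z ↔ S.SystemE1 K 𝒯 z ∧ S.SystemE2 K 𝒯 z := by
  have hSc := hS.Sc_eq hz
  have htt : ∀ α β, S.Ric (tI n α) (tI n β) z - S.Sc z / 2 * S.GLow (tI n α) (tI n β) z
        = K * 𝒯 (tI n α) (tI n β) ↔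
      ricci S.h α β z.1 - S.sH z / 2 * S.hLow z α β = K * S.tT K 𝒯 α β z := by
    intro α β
    have : K * S.tT K 𝒯 α β z
        = K * 𝒯 (tI n α) (tI n β) + (S.sR z + S.sS z) / 2 * S.hLow z α β := by
      rw [tT]
      field_simp
    rw [this, GLow_tI_tI, hS.Ric_tI_tI hz, hSc]
    constructor <;> intro h <;> linear_combination h
  have hxx : ∀ i j, S.Ric (xI p i) (xI p j) z - S.Sc z / 2 * S.GLow (xI p i) (xI p j) z
        = K * 𝒯 (xI p i) (xI p j) ↔
      ricci S.φ i j z.2.1 - scalar S.φ z.2.1 / 2 * S.φLow z i j + S.ρ i j z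
        = K * S.tX K 𝒯 i j z := by
    intro i j
    have : K * S.tX K 𝒯 i j z = K * 𝒯 (xI p i) (xI p j)
        + (S.sH z + S.sS z) / 2 * (Real.exp (2 * S.σ z) * S.φLow z i j) := by
      rw [tX]
      field_simp
    rw [this, ← hS.Ric_xI_xI_sub_half_sR hz, GLow_xI_xI, hSc]
    constructor <;> intro h <;> linear_combination h
  have hvv : ∀ i α j β, S.Ric (vI i α) (vI j β) z - S.Sc z / 2 * S.GLow (vI i α) (vI j β) z
        = K * 𝒯 (vI i α) (vI j β) ↔
      S.Ric (vI i α) (vI j β) z + ((n : ℝ) - 1) * S.trtrσ z * S.hUp z α β * S.φLow z i j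
        = K * S.tV K 𝒯 i α j β z := by
    intro i α j β
    have : K * S.tV K 𝒯 i α j β z = K * 𝒯 (vI i α) (vI j β)
        + (S.sH z + S.sR z) / 2 * (S.hUp z α β * Real.exp (2 * S.σ z) * S.φLow z i j) := by
      rw [tV]
      field_simp
    have hs := hS.exp_mul_sS hz
    rw [this, GLow_vI_vI, hSc]
    constructor <;> intro h
    -- `hs` trades -(S/2) e^{2σ} for (n - 1)<<σ>>.
    · linear_combination h + (S.hUp z α β * S.φLow z i j / 2) * hs
    · linear_combination h - (S.hUp z α β * S.φLow z i j / 2) * hs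
  have hzero : ∀ x : ℝ, 0 = K * x ↔ 0 = x := by
    intro x
    rw [eq_comm, mul_eq_zero, or_iff_right hK, eq_comm]
  have hsplit : S.EinsteinEquations K 𝒯 z ↔ ∀ A B : Idx p n,
      S.Ric A B z - S.Sc z / 2 * S.GLow A B z = K * 𝒯 A B := Iff.rfl
  rw [hsplit]
  simp only [Sum.forall, Prod.forall, htt, hxx, hvv, GLow_tI_xI, GLow_xI_tI, GLow_tI_vI,
    GLow_vI_tI, GLow_xI_vI, GLow_vI_xI, hS.Ric_tI_xI hz, hS.Ric_tI_vI hz, mul_zero, sub_zero,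
    hzero, SystemE1, SystemE2, forall_and]
  tauto

end RegularOn

/-- The bridge from manifolds to coordinates: all later analysis uses only these properties on the
chart targets. -/
theorem regularOn_ofCharts {T M : Type*} [TopologicalSpace T] [ChartedSpace (Eu p) T]
    [TopologicalSpace M] [ChartedSpace (Eu n) M] (h : SemiRiemannianMetric p T)
    (φ : SemiRiemannianMetric n M) {σ : OneJet p n T M → ℝ} (hσ : IsSmoothOnJets σ)
    {e : OpenPartialHomeomorph T (Eu p)} (he : e ∈ IsManifold.maximalAtlas (𝓡 p) ∞ T)
    {e' : OpenPartialHomeomorph M (Eu n)} (he' : e' ∈ IsManifold.maximalAtlas (𝓡 n) ∞ M) :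
    (ofCharts h φ σ e e').RegularOn e.target e'.target where
  isOpen_left := e.open_target
  isOpen_right := e'.open_target
  contDiffOn_h := h.smooth e he
  contDiffOn_φ := φ.smooth e' he'
  isUnit_det_h _ ht := h.isUnit_det_components he ht
  isUnit_det_φ _ hx := φ.isUnit_det_components he' hx
  isSymm_φ := φ.components_isSymm e'
  contDiffOn_σ := hσ e he e' he'

end Space
end JetGR

end

theorem mainTheorem7 {p n : ℕ} (hp : 2 < p) (hn : 2 < n)
    {T : Type*} [TopologicalSpace T] [ChartedSpace (JetGR.Eu p) T] [IsManifold (𝓡 p) ∞ T]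
    {M : Type*} [TopologicalSpace M] [ChartedSpace (JetGR.Eu n) M] [IsManifold (𝓡 n) ∞ M]
    (h : JetGR.SemiRiemannianMetric p T) (φ : JetGR.SemiRiemannianMetric n M)
    (σ : JetGR.OneJet p n T M → ℝ) (hσ : JetGR.IsSmoothOnJets σ)
    (𝒯 : JetGR.DTensor p n T M) (K : ℝ) (hK : K ≠ 0)
    (e : OpenPartialHomeomorph T (JetGR.Eu p)) (he : e ∈ IsManifold.maximalAtlas (𝓡 p) ∞ T)
    (e' : OpenPartialHomeomorph M (JetGR.Eu n)) (he' : e' ∈ IsManifold.maximalAtlas (𝓡 n) ∞ M)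
    (z : JetGR.Coords p n) (hz : z ∈ JetGR.jetDomain e e') :
    (JetGR.Space.ofCharts h φ σ e e').EinsteinEquations K (𝒯.components e e' z) z ↔
      (JetGR.Space.ofCharts h φ σ e e').SystemE1 K (𝒯.components e e' z) z ∧
      (JetGR.Space.ofCharts h φ σ e e').SystemE2 K (𝒯.components e e' z) z :=
  -- `jetDomain e e'` and `jetsOver e.target e'.target` agree by definition, so `hz` serves as it
  -- is.
  (JetGR.Space.regularOn_ofCharts h φ hσ he he').einsteinEquations_iff hz hK _
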